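/- Let $\mathfrak g$ be a finite-dimensional complex Lie algebra, $G$ the connected and simply connected Lie group with Lie algebra $\mathfrak g$, and $\tau$ a finite-dimensional complex representation of $\mathfrak g$ on $V_\tau$; $G$ acts on $\operatorname{End}V_\tau$ by $A\mapsto\tau(g)A\tau(g)^{-1}$ and on algebras generated by $\mathfrak g$ by $\mathrm{Ad}$. For $t\in\mathbb C$ put $U_t(\mathfrak g)=T(\mathfrak g)/(X\otimes Y-Y\otimes X-t[X,Y])$, and define $$\mathcal C_\tau(\mathfrak g)=(\operatorname{End}V_\tau\otimes S(\mathfrak g))^G,\qquad \mathcal Q^t_\tau(\mathfrak g)=(\operatorname{End}V_\tau\otimes U_t(\mathfrak g))^G,\qquad \mathcal Q_\tau(\mathfrak g)=\mathcal Q^1_\tau(\mathfrak g).$$ Let $F_t=\mathrm{id}\otimes I_t:\operatorname{End}V_\tau\otimes S(\mathfrak g)\to\operatorname{End}V_\tau\otimes U_t(\mathfrak g)$, where $I_t(X_1\cdots X_k)=\frac1{k!}\sum_{\sigma\in S_k}X_{\sigma(1)}\cdots X_{\sigma(k)}$ is the Poincaré–Birkhoff–Witt map. Let $P$ be the bilinear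 map on $\operatorname{End}V_\tau\otimes S(\mathfrak g)$ with $$P(A\otimes a,B\otimes b)=AB\otimes\{a,b\},\qquad \{a,b\}=\sum_{i,j,k}c_{ij}^k\,X_k\,\partial^ia\,\partial^jb,$$ for a basis $(X_i)$ of $\mathfrak g$ with structure constants $c_{ij}^k$. A formal deformation of an associative $\mathbb C$-algebra $A$ is a sequence of bilinear maps $m_k:A\times A\to A$ $(k\ge0)$ with $m_0(a,b)=ab$ such that the $\mathbb C[[t]]$-bilinear extension to $A[[t]]$ of $m(a,b)=\sum_k t^km_k(a,b)$ is associative. It is infinitesimally trivial if there is a linear map $\theta_1:A\to A$ such that $\theta=\mathrm{id}+t\theta_1$ satisfies $\theta(ab)=m(\theta(a),\theta(b))$ modulo $t^2$ for all $a,b\in A$. Then: 1. For every $t\in\mathbb C$ the map $F_t$ is bijective and restricts to a bijection $\mathcal C_\tau(\mathfrak g)\to\mathcal Q^t_\tau(\mathfrak g)$. Let $\mathcal A*_t\mathcal B=F_t^{-1}(F_t(\mathcal A)\cdot F_t(\mathcal B))$. 2. There is exactly one formal deformation $m$ of $\mathcal C_\tau(\mathfrak g)$ such that for all $\mathcal A,\mathcal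 B\in\mathcal C_\tau(\mathfrak g)$ only finitely many $m_k(\mathcal A,\mathcal B)$ are nonzero and $\mathcal A*_t\mathcal B=\sum_k t^km_k(\mathcal A,\mathcal B)$ for all $t\in\mathbb C$. This is the deformation from $\mathcal C_\tau(\mathfrak g)$ to $\mathcal Q_\tau(\mathfrak g)$. 3. Its first-order term is $m_1=\frac12P$ on $\mathcal C_\tau(\mathfrak g)$, and $m_1$ is a Hochschild $2$-coboundary of $\mathcal C_\tau(\mathfrak g)$: there is a linear map $f:\mathcal C_\tau(\mathfrak g)\to\mathcal C_\tau(\mathfrak g)$ with $m_1(\mathcal A,\mathcal B)=\mathcal A f(\mathcal B)-f(\mathcal A\mathcal B)+f(\mathcal A)\mathcal B$ for all $\mathcal A,\mathcal B$. Moreover, the deformation $m$ is infinitesimally trivial. -/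

import Mathlib

open scoped TensorProduct PowerSeries

namespace FamilyAlgebra
noncomputable section

/-- The exponential `e^f` of an endomorphism of a finite-dimensional complex vector space, computed
as a matrix exponential in some basis (it does not depend on the basis, see `linExp_hasSum`). -/
def linExp {W : Type*} [AddCommGroup W] [Module ℂ W] [FiniteDimensional ℂ W]
    (f : Module.End ℂ W) : Module.End ℂ W :=
  LinearMap.toMatrixAlgEquiv (Module.finBasis ℂ W) |>.symm
    (NormedSpace.exp (LinearMap.toMatrixAlgEquiv (Module.finBasis ℂ W) f))

section LinExp

variable {W : Type*} [AddCommGroup W] [Module ℂ W] [FiniteDimensional ℂ W]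

theorem linExp_zero : linExp (0 : Module.End ℂ W) = 1 := by
  simp [linExp, NormedSpace.exp_zero]

theorem linExp_add {f g : Module.End ℂ W} (h : Commute f g) :
    linExp (f + g) = linExp f * linExp g := by
  unfold linExp
  rw [map_add, Matrix.exp_add_of_commute, map_mul]
  exact h.map _

/-- Basis-free description: `e^f w` is the (weak, i.e. coordinatewise) sum of `f^n w / n!`. -/
theorem linExp_hasSum (f : Module.End ℂ W) (w : W) (φ : Module.Dual ℂ W) :
    HasSum (fun n : ℕ => (n.factorial : ℂ)⁻¹ * φ ((f ^ n) w)) (φ (linExp f w)) := by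
  set e := LinearMap.toMatrixAlgEquiv (Module.finBasis ℂ W) with he
  have h : HasSum (fun n : ℕ => ((n.factorial : ℂ)⁻¹) • (e f) ^ n) (NormedSpace.exp (e f)) := by
    let _ : SeminormedRing (Matrix (Fin (Module.finrank ℂ W)) (Fin (Module.finrank ℂ W)) ℂ) :=
      Matrix.linftyOpSemiNormedRing
    let _ : NormedRing (Matrix (Fin (Module.finrank ℂ W)) (Fin (Module.finrank ℂ W)) ℂ) :=
      Matrix.linftyOpNormedRing
    let _ : NormedAlgebra ℂ (Matrix (Fin (Module.finrank ℂ W)) (Fin (Module.finrank ℂ W)) ℂ) :=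
      Matrix.linftyOpNormedAlgebra
    exact NormedSpace.exp_series_hasSum_exp' (𝕂 := ℂ) (e f)
  let T : Matrix (Fin (Module.finrank ℂ W)) (Fin (Module.finrank ℂ W)) ℂ →ₗ[ℂ] ℂ :=
    φ ∘ₗ (LinearMap.applyₗ w) ∘ₗ e.symm.toLinearMap
  have hT : Continuous T := LinearMap.continuous_of_finiteDimensional T
  have := h.map T.toAddMonoidHom hT
  convert this using 2 with n
  · simp [T, map_pow]
  · rfl

end LinExp
/-- The exponential of an endomorphism, as an element of the general linear group. -/
def expEquiv {W : Type*} [AddCommGroup W] [Module ℂ W] [FiniteDimensional ℂ W]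
    (f : Module.End ℂ W) : W ≃ₗ[ℂ] W :=
  LinearEquiv.ofLinearMap (linExp f) (linExp (-f))
    (by
      have h := linExp_add (Commute.neg_right (Commute.refl f))
      rw [add_neg_cancel, linExp_zero] at h
      exact h.symm)
    (by
      have h := linExp_add (Commute.neg_left (Commute.refl f))
      rw [neg_add_cancel, linExp_zero] at h
      exact h.symm)

/-- The exponential of `ad X` preserves the Lie bracket. -/
theorem linExp_ad_lie {𝔤 : Type*} [LieRing 𝔤] [LieAlgebra ℂ 𝔤] [FiniteDimensional ℂ 𝔤]
    (X y z : 𝔤) :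
    linExp (LieAlgebra.ad ℂ 𝔤 X) ⁅y, z⁆ =
      ⁅linExp (LieAlgebra.ad ℂ 𝔤 X) y, linExp (LieAlgebra.ad ℂ 𝔤 X) z⁆ := by
  set D := LieAlgebra.ad ℂ 𝔤 X with hD
  set b := Module.finBasis ℂ 𝔤
  have hlie : ∀ u v : 𝔤, ⁅u, v⁆ = ∑ p, ∑ q, (b.repr u p * b.repr v q) • ⁅b p, b q⁆ := by
    intro u v
    conv_lhs => rw [← b.sum_repr u, ← b.sum_repr v]
    simp only [sum_lie, lie_sum, smul_lie, lie_smul, Finset.smul_sum, smul_smul]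
    rw [Finset.sum_comm]
    exact Finset.sum_congr rfl fun p _ => Finset.sum_congr rfl fun q _ => by rw [mul_comm]
  have hiter : ∀ n : ℕ, (D ^ n) ⁅y, z⁆ =
      ∑ ij ∈ Finset.HasAntidiagonal.antidiagonal n, Nat.choose n ij.1 • ⁅(D ^ ij.1) y, (D ^ ij.2) z⁆ := by
    intro n
    have := LieDerivation.iterate_apply_lie (LieDerivation.ad ℂ 𝔤 X) n y z
    have hDD : ∀ (k : ℕ) (u : 𝔤), (⇑(LieDerivation.ad ℂ 𝔤 X))^[k] u = (D ^ k) u := by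
      intro k u
      rw [Module.End.pow_apply]
      have hc : ⇑(LieDerivation.ad ℂ 𝔤 X) = ⇑D := by funext v; simp [hD]
      rw [hc]
    simpa only [hDD] using this
  apply b.ext_elem
  intro r
  set φ : 𝔤 →ₗ[ℂ] ℂ := b.coord r
  have hs : ∀ (u : 𝔤) (p), Summable fun n : ℕ => ‖(n.factorial : ℂ)⁻¹ * b.coord p ((D ^ n) u)‖ :=
    fun u p => (linExp_hasSum D u (b.coord p)).summable.norm
  have key : ∀ p q, HasSum (fun n : ℕ => ∑ ij ∈ Finset.HasAntidiagonal.antidiagonal n,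
      ((ij.1.factorial : ℂ)⁻¹ * b.coord p ((D ^ ij.1) y)) *
        ((ij.2.factorial : ℂ)⁻¹ * b.coord q ((D ^ ij.2) z)))
      (b.coord p (linExp D y) * b.coord q (linExp D z)) := by
    intro p q
    rw [← (linExp_hasSum D y (b.coord p)).tsum_eq, ← (linExp_hasSum D z (b.coord q)).tsum_eq,
      tsum_mul_tsum_eq_tsum_sum_antidiagonal_of_summable_norm (hs y p) (hs z q)]
    exact (summable_norm_sum_mul_antidiagonal_of_summable_norm (hs y p) (hs z q)).of_norm.hasSum
  have total := hasSum_sum (s := Finset.univ) fun p _ => hasSum_sum (s := Finset.univ)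
    fun q _ => (key p q).mul_right (φ ⁅b p, b q⁆)
  have h1 := linExp_hasSum D ⁅y, z⁆ φ
  have h2 : φ ⁅linExp D y, linExp D z⁆ = ∑ p, ∑ q,
      b.coord p (linExp D y) * b.coord q (linExp D z) * φ ⁅b p, b q⁆ := by
    rw [hlie]; simp [map_sum]
  change φ _ = φ _
  rw [h2]
  refine h1.unique (Eq.mp (congrArg (fun f => HasSum f _) (funext fun n => Eq.symm ?_)) total)
  rw [hiter, map_sum, Finset.mul_sum]
  simp_rw [Finset.sum_mul]
  rw [Finset.sum_congr rfl fun p _ => Finset.sum_comm, Finset.sum_comm]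
  refine Finset.sum_congr rfl fun ij hij => ?_
  rw [hlie, map_nsmul, map_sum, nsmul_eq_mul, Finset.mul_sum, Finset.mul_sum]
  refine Finset.sum_congr rfl fun p _ => ?_
  rw [map_sum, Finset.mul_sum, Finset.mul_sum]
  refine Finset.sum_congr rfl fun q _ => ?_
  have hn : ij.1 + ij.2 = n := by simpa using hij
  have hf : ((n.choose ij.1 : ℂ) * ij.1.factorial * ij.2.factorial) = n.factorial := by
    subst hn
    rw [Nat.choose_symm_add]
    exact_mod_cast Nat.add_choose_mul_factorial_mul_factorial ij.1 ij.2
  rw [← hf]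
  have h1 : (ij.1.factorial : ℂ) ≠ 0 := by exact_mod_cast ij.1.factorial_ne_zero
  have h2 : (ij.2.factorial : ℂ) ≠ 0 := by exact_mod_cast ij.2.factorial_ne_zero
  have h3 : (n.choose ij.1 : ℂ) ≠ 0 := by
    exact_mod_cast (Nat.choose_pos (by omega)).ne'
  rw [map_smul, smul_eq_mul]
  simp only [Module.Basis.coord_apply]
  field_simp

/-- `Ad(exp X) = e^{ad X}`, an automorphism of the Lie algebra `𝔤`. -/
def expAd {𝔤 : Type*} [LieRing 𝔤] [LieAlgebra ℂ 𝔤] [FiniteDimensional ℂ 𝔤] (X : 𝔤) :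
    𝔤 ≃ₗ⁅ℂ⁆ 𝔤 :=
  { expEquiv (LieAlgebra.ad ℂ 𝔤 X) with
    map_lie' := fun {y z} => linExp_ad_lie X y z }

section Enveloping

variable (𝔤 : Type*) [LieRing 𝔤] [LieAlgebra ℂ 𝔤]

/-- The relations `x ⊗ y - y ⊗ x = t [x, y]` in the tensor algebra of `𝔤`. -/
inductive DeformedRel (t : ℂ) : TensorAlgebra ℂ 𝔤 → TensorAlgebra ℂ 𝔤 → Prop
  | comm (x y : 𝔤) : DeformedRel t (TensorAlgebra.ι ℂ x * TensorAlgebra.ι ℂ y)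
      (TensorAlgebra.ι ℂ y * TensorAlgebra.ι ℂ x + t • TensorAlgebra.ι ℂ ⁅x, y⁆)

/-- The algebra `U_t(𝔤) = T(𝔤) / (x ⊗ y - y ⊗ x - t [x, y])`; the universal enveloping algebra
`U(𝔤)` is `U_1(𝔤)`. -/
def DeformedU (t : ℂ) : Type _ := RingQuot (DeformedRel 𝔤 t)

instance (t : ℂ) : Ring (DeformedU 𝔤 t) := inferInstanceAs (Ring (RingQuot (DeformedRel 𝔤 t)))

instance (t : ℂ) : Algebra ℂ (DeformedU 𝔤 t) :=
  inferInstanceAs (Algebra ℂ (RingQuot (DeformedRel 𝔤 t)))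

namespace DeformedU

/-- The quotient map `T(𝔤) → U_t(𝔤)`. -/
def mk (t : ℂ) : TensorAlgebra ℂ 𝔤 →ₐ[ℂ] DeformedU 𝔤 t :=
  RingQuot.mkAlgHom ℂ (DeformedRel 𝔤 t)

variable {𝔤}

/-- The canonical linear map `𝔤 → U_t(𝔤)`. -/
def ι (t : ℂ) : 𝔤 →ₗ[ℂ] DeformedU 𝔤 t := (mk 𝔤 t).toLinearMap ∘ₗ TensorAlgebra.ι ℂ

theorem ι_mul_ι (t : ℂ) (x y : 𝔤) : ι t x * ι t y = ι t y * ι t x + t • ι t ⁅x, y⁆ := by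
  have h : mk 𝔤 t _ = mk 𝔤 t _ := RingQuot.mkAlgHom_rel ℂ (DeformedRel.comm (t := t) x y)
  simpa [ι, map_mul, map_add, map_smul] using h

/-- The universal property of `U_t(𝔤)`. -/
def lift {A : Type*} [Ring A] [Algebra ℂ A] (t : ℂ) (f : 𝔤 →ₗ[ℂ] A)
    (hf : ∀ x y, f x * f y = f y * f x + t • f ⁅x, y⁆) : DeformedU 𝔤 t →ₐ[ℂ] A :=
  RingQuot.liftAlgHom ℂ ⟨TensorAlgebra.lift ℂ f, by
    rintro _ _ ⟨x, y⟩
    simpa using hf x y⟩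

@[simp]
theorem lift_ι {A : Type*} [Ring A] [Algebra ℂ A] (t : ℂ) (f : 𝔤 →ₗ[ℂ] A)
    (hf : ∀ x y, f x * f y = f y * f x + t • f ⁅x, y⁆) (x : 𝔤) : lift t f hf (ι t x) = f x := by
  simp only [lift, ι, mk, LinearMap.comp_apply]
  erw [RingQuot.liftAlgHom_mkAlgHom_apply]
  simp

/-- The endomorphism of `U_t(𝔤)` induced by an automorphism of the Lie algebra `𝔤`. -/
def map (t : ℂ) (φ : 𝔤 ≃ₗ⁅ℂ⁆ 𝔤) : DeformedU 𝔤 t →ₐ[ℂ] DeformedU 𝔤 t :=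
  lift t (ι t ∘ₗ (φ : 𝔤 →ₗ[ℂ] 𝔤)) fun x y => by
    have h := ι_mul_ι t (φ x) (φ y)
    rw [← LieEquiv.map_lie] at h
    exact h

end DeformedU

variable {𝔤}

/-- The symmetrized product `(x₁, …, x_k) ↦ (1 / k!) ∑_σ x_σ(1) ⋯ x_σ(k)` in `U_t(𝔤)`, as a
multilinear map. -/
def symProd (t : ℂ) (k : ℕ) : MultilinearMap ℂ (fun _ : Fin k => 𝔤) (DeformedU 𝔤 t) :=
  (k.factorial : ℂ)⁻¹ • ∑ σ : Equiv.Perm (Fin k),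
    ((MultilinearMap.mkPiAlgebraFin ℂ k (DeformedU 𝔤 t)).compLinearMap
      fun _ => DeformedU.ι t).domDomCongr σ

theorem symProd_apply (t : ℂ) (k : ℕ) (x : Fin k → 𝔤) :
    symProd t k x = (k.factorial : ℂ)⁻¹ • ∑ σ : Equiv.Perm (Fin k),
      (List.ofFn fun i => DeformedU.ι t (x (σ i))).prod := by
  simp [symProd]

theorem symProd_perm (t : ℂ) (k : ℕ) (x : Fin k → 𝔤) (ρ : Equiv.Perm (Fin k)) :
    symProd t k (x ∘ ρ) = symProd t k x := by
  rw [symProd_apply, symProd_apply]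
  congr 1
  exact Fintype.sum_equiv (Equiv.mulLeft ρ) _ _ fun σ => rfl

variable (𝔤) in
/-- The Poincaré–Birkhoff–Witt (symmetrization) map `S(𝔤) → U_t(𝔤)`, defined on the monomials in a
basis of `𝔤`; by `pbw_prod` it sends every product `x₁ ⋯ x_k` of elements of `𝔤` to its symmetrized
product, so it does not depend on the basis. -/
def pbw [FiniteDimensional ℂ 𝔤] (t : ℂ) : SymmetricAlgebra ℂ 𝔤 →ₗ[ℂ] DeformedU 𝔤 t :=
  (Module.finBasis ℂ 𝔤).symmetricAlgebra.constr ℂ fun s =>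
    symProd t _ fun i : Fin (Finsupp.toMultiset s).toList.length =>
      Module.finBasis ℂ 𝔤 ((Finsupp.toMultiset s).toList.get i)

/-- The defining formula of the Poincaré–Birkhoff–Witt map:
`x₁ ⋯ x_k ↦ (1 / k!) ∑_σ x_σ(1) ⋯ x_σ(k)` for all `x₁, …, x_k` in `𝔤`. -/
theorem pbw_prod [FiniteDimensional ℂ 𝔤] (t : ℂ) (k : ℕ) (x : Fin k → 𝔤) :
    pbw 𝔤 t (∏ i, SymmetricAlgebra.ι ℂ 𝔤 (x i)) =
      (k.factorial : ℂ)⁻¹ • ∑ σ : Equiv.Perm (Fin k),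
        (List.ofFn fun i => DeformedU.ι t (x (σ i))).prod := by
  rw [← symProd_apply]
  set b := Module.finBasis ℂ 𝔤 with hb
  have key : (pbw 𝔤 t).compMultilinearMap ((MultilinearMap.mkPiAlgebra ℂ (Fin k)
      (SymmetricAlgebra ℂ 𝔤)).compLinearMap fun _ => SymmetricAlgebra.ι ℂ 𝔤) = symProd t k := by
    refine Module.Basis.ext_multilinear (fun _ => b) fun v => ?_
    have h1 : ((pbw 𝔤 t).compMultilinearMap ((MultilinearMap.mkPiAlgebra ℂ (Fin k)
        (SymmetricAlgebra ℂ 𝔤)).compLinearMap fun _ => SymmetricAlgebra.ι ℂ 𝔤))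
          (fun i => b (v i)) =
        pbw 𝔤 t (b.symmetricAlgebra (∑ i, Finsupp.single (v i) 1)) := by
      simp only [LinearMap.compMultilinearMap_apply, MultilinearMap.compLinearMap_apply,
        MultilinearMap.mkPiAlgebra_apply]
      congr 1
      apply (SymmetricAlgebra.equivMvPolynomial b).injective
      simp [Module.Basis.symmetricAlgebra, map_prod, MvPolynomial.X,
        MvPolynomial.monomial_sum_one]
    rw [h1, pbw, Module.Basis.constr_basis]
    have h2 : ((Finsupp.toMultiset (∑ i, Finsupp.single (v i) 1)).toList : Multiset _) =
        Finset.univ.val.map v := by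
      rw [Multiset.coe_toList, map_sum, ← Multiset.sum_map_singleton (Finset.univ.val.map v),
        Multiset.map_map]
      simp [Finset.sum]
    generalize (Finsupp.toMultiset (∑ i, Finsupp.single (v i) 1)).toList = l at h2
    have hl : l.length = k := by simpa using congrArg Multiset.card h2
    subst hl
    have h3 : Finset.univ.val.map l.get = Finset.univ.val.map v := by
      rw [← h2]
      simp
    have hc : ∀ c, Fintype.card {i // l.get i = c} = Fintype.card {i // v i = c} := by
      intro c
      have := congrArg (Multiset.count c) h3
      rw [Multiset.count_map, Multiset.count_map] at this
      rw [Fintype.card_subtype, Fintype.card_subtype]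
      simpa [Finset.card, eq_comm] using this
    let σ : Equiv.Perm (Fin l.length) :=
      Equiv.ofFiberEquiv fun c => Fintype.equivOfCardEq (hc c)
    have hσ : ∀ i, v (σ i) = l.get i := fun i => Equiv.ofFiberEquiv_map _ i
    have := symProd_perm t _ (fun i => b (v i)) σ
    rw [← this]
    congr 1
    funext i
    exact congrArg b (hσ i).symm
  exact congrArg (fun f => f x) key

end Enveloping

/-- The tensor product `A ⊗ B` of two complex algebras, with `(a ⊗ b) (a' ⊗ b') = a a' ⊗ b b'`. -/
abbrev AlgebraTensor (A B : Type*) [Ring A] [Algebra ℂ A] [Ring B] [Algebra ℂ B] : Type _ :=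
  A ⊗[ℂ] B

section Group

/- The connected and simply connected Lie group `G` with Lie algebra `𝔤` is generated by `exp 𝔤`,
so each of its elements is a product `g = exp X₁ ⋯ exp Xₙ`. It acts on `𝔤` by
`Ad(g) = e^{ad X₁} ⋯ e^{ad Xₙ}` and on `V` by `τ(g) = e^{τ(X₁)} ⋯ e^{τ(Xₙ)}`. Below, the list
`[X₁, …, Xₙ]` stands for this element of `G`; every element of `G` is named by some list. -/

variable (𝔤 : Type*) [LieRing 𝔤] [LieAlgebra ℂ 𝔤] [FiniteDimensional ℂ 𝔤]
variable (V : Type*) [AddCommGroup V] [Module ℂ V] [FiniteDimensional ℂ V]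
  [LieRingModule 𝔤 V] [LieModule ℂ 𝔤 V]

variable {𝔤} in
/-- `Ad(g)` for `g = exp X₁ ⋯ exp Xₙ`. -/
def groupAd : List 𝔤 → (𝔤 ≃ₗ⁅ℂ⁆ 𝔤)
  | [] => LieEquiv.refl
  | X :: l => (groupAd l).trans (expAd X)

variable {𝔤} in
/-- `τ(g)` for `g = exp X₁ ⋯ exp Xₙ`. -/
def groupRep : List 𝔤 → (V ≃ₗ[ℂ] V)
  | [] => LinearEquiv.refl ℂ V
  | X :: l => (groupRep l).trans (expEquiv (LieModule.toEnd ℂ 𝔤 V X))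

/-- The matrix algebra `End V ⊗ S(𝔤)`, with product `(A ⊗ a) (B ⊗ b) = A B ⊗ a b`. -/
abbrev ClassicalMatrix : Type _ := AlgebraTensor (Module.End ℂ V) (SymmetricAlgebra ℂ 𝔤)

/-- The matrix algebra `End V ⊗ U_t(𝔤)`, with product `(A ⊗ a) (B ⊗ b) = A B ⊗ a b`. -/
abbrev QuantumMatrix (t : ℂ) : Type _ := AlgebraTensor (Module.End ℂ V) (DeformedU 𝔤 t)

variable {𝔤} in
/-- The action `g · (A ⊗ a) = τ(g) A τ(g)⁻¹ ⊗ Ad(g) a` on `End V ⊗ S(𝔤)`. -/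
def classicalAction (g : List 𝔤) : ClassicalMatrix 𝔤 V →ₐ[ℂ] ClassicalMatrix 𝔤 V :=
  Algebra.TensorProduct.map ((groupRep V g).conjAlgEquiv ℂ).toAlgHom
    (SymmetricAlgebra.lift (SymmetricAlgebra.ι ℂ 𝔤 ∘ₗ (groupAd g : 𝔤 →ₗ[ℂ] 𝔤)))

variable {𝔤} in
/-- The action `g · (A ⊗ a) = τ(g) A τ(g)⁻¹ ⊗ Ad(g) a` on `End V ⊗ U_t(𝔤)`. -/
def quantumAction (t : ℂ) (g : List 𝔤) : QuantumMatrix 𝔤 V t →ₐ[ℂ] QuantumMatrix 𝔤 V t :=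
  Algebra.TensorProduct.map ((groupRep V g).conjAlgEquiv ℂ).toAlgHom
    (DeformedU.map t (groupAd g))

/-- The classical family algebra `𝒞_τ(𝔤) = (End V ⊗ S(𝔤))^G`. -/
def classicalFamilyAlgebra : Subalgebra ℂ (ClassicalMatrix 𝔤 V) :=
  ⨅ g : List 𝔤, AlgHom.equalizer (classicalAction V g) (AlgHom.id ℂ _)

/-- The quantum family algebra `𝒬^t_τ(𝔤) = (End V ⊗ U_t(𝔤))^G`; `𝒬_τ(𝔤)` is the case `t = 1`. -/
def quantumFamilyAlgebra (t : ℂ) : Subalgebra ℂ (QuantumMatrix 𝔤 V t) :=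
  ⨅ g : List 𝔤, AlgHom.equalizer (quantumAction V t g) (AlgHom.id ℂ _)

theorem mem_classicalFamilyAlgebra {a : ClassicalMatrix 𝔤 V} :
    a ∈ classicalFamilyAlgebra 𝔤 V ↔ ∀ g : List 𝔤, classicalAction V g a = a := by
  simp [classicalFamilyAlgebra, Algebra.mem_iInf, AlgHom.mem_equalizer]

theorem mem_quantumFamilyAlgebra {t : ℂ} {a : QuantumMatrix 𝔤 V t} :
    a ∈ quantumFamilyAlgebra 𝔤 V t ↔ ∀ g : List 𝔤, quantumAction V t g a = a := by
  simp [quantumFamilyAlgebra, Algebra.mem_iInf, AlgHom.mem_equalizer]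

/-- The Poincaré–Birkhoff–Witt map `F = id ⊗ pbw : End V ⊗ S(𝔤) → End V ⊗ U_t(𝔤)`. -/
def familyPBW (t : ℂ) : ClassicalMatrix 𝔤 V →ₗ[ℂ] QuantumMatrix 𝔤 V t :=
  LinearMap.lTensor (Module.End ℂ V) (pbw 𝔤 t)

variable {𝔤 V} in
/-- The star-product `a *_t b = F⁻¹ (F a · F b)`. The map `F` is bijective (Poincaré–Birkhoff–Witt),
so that `invFun` is its inverse. -/
def starProduct (t : ℂ) (a b : ClassicalMatrix 𝔤 V) : ClassicalMatrix 𝔤 V :=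
  Function.invFun (familyPBW 𝔤 V t) (familyPBW 𝔤 V t a * familyPBW 𝔤 V t b)

end Group

section Poisson

variable {𝔤 : Type*} [LieRing 𝔤] [LieAlgebra ℂ 𝔤] {κ : Type*} [Fintype κ]

/-- The partial derivative `∂^i` of `S(W)` with respect to a basis `X` of `W`. -/
def partialDeriv {W : Type*} [AddCommGroup W] [Module ℂ W] {κ : Type*}
    (X : Module.Basis κ ℂ W) (i : κ) :
    SymmetricAlgebra ℂ W →ₗ[ℂ] SymmetricAlgebra ℂ W :=
  (SymmetricAlgebra.equivMvPolynomial X).symm.toLinearMap ∘ₗ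
    (MvPolynomial.pderiv i : Derivation ℂ (MvPolynomial κ ℂ) _).toLinearMap ∘ₗ
      (SymmetricAlgebra.equivMvPolynomial X).toLinearMap

/-- The Poisson bracket `{a, b} = ∑ [X_i, X_j] · ∂^i a · ∂^j b` on `S(𝔤)`. -/
def poisson (X : Module.Basis κ ℂ 𝔤) :
    SymmetricAlgebra ℂ 𝔤 →ₗ[ℂ] SymmetricAlgebra ℂ 𝔤 →ₗ[ℂ] SymmetricAlgebra ℂ 𝔤 :=
  ∑ i, ∑ j, ((LinearMap.mul ℂ (SymmetricAlgebra ℂ 𝔤)).compl₁₂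
    (partialDeriv X i) (partialDeriv X j)).compr₂
      (LinearMap.mulLeft ℂ (SymmetricAlgebra.ι ℂ 𝔤 ⁅X i, X j⁆))

/-- The Poisson bracket through the structure constants of the basis:
`{a, b} = ∑ c_{ij}^k X_k · ∂^i a · ∂^j b`. -/
theorem poisson_apply (X : Module.Basis κ ℂ 𝔤) (a b : SymmetricAlgebra ℂ 𝔤) :
    poisson X a b = ∑ i, ∑ j, ∑ k, X.repr ⁅X i, X j⁆ k •
      (SymmetricAlgebra.ι ℂ 𝔤 (X k) * partialDeriv X i a * partialDeriv X j b) := by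
  simp only [poisson, LinearMap.sum_apply, LinearMap.compr₂_apply, LinearMap.compl₁₂_apply,
    LinearMap.mul_apply', LinearMap.mulLeft_apply]
  refine Finset.sum_congr rfl fun i _ => Finset.sum_congr rfl fun j _ => ?_
  conv_lhs => rw [← X.sum_repr ⁅X i, X j⁆]
  rw [map_sum, Finset.sum_mul]
  simp [mul_assoc]

variable (V : Type*) [AddCommGroup V] [Module ℂ V]

/-- The noncommutative Poisson bracket `P`, the bilinear map with
`P (A ⊗ a, B ⊗ b) = A B ⊗ {a, b}`. -/
def familyPoisson (X : Module.Basis κ ℂ 𝔤) :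
    ClassicalMatrix 𝔤 V →ₗ[ℂ] ClassicalMatrix 𝔤 V →ₗ[ℂ] ClassicalMatrix 𝔤 V :=
  TensorProduct.map₂ (LinearMap.mul ℂ (Module.End ℂ V)) (poisson X)

theorem familyPoisson_tmul (X : Module.Basis κ ℂ 𝔤) (A B : Module.End ℂ V)
    (a b : SymmetricAlgebra ℂ 𝔤) :
    familyPoisson V X (A ⊗ₜ[ℂ] a) (B ⊗ₜ[ℂ] b) = (A * B) ⊗ₜ[ℂ] poisson X a b := by
  simp [familyPoisson]

end Poisson

section Deformation

variable (A : Type*) [Ring A] [Algebra ℂ A]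

variable {A} in
/-- The Hochschild differential `C¹(A, A) → C²(A, A)`:
`(d f)(a, b) = a f(b) - f(a b) + f(a) b`. -/
def hochschildD (f : A →ₗ[ℂ] A) : A →ₗ[ℂ] A →ₗ[ℂ] A :=
  LinearMap.mk₂ ℂ (fun a b => a * f b - f (a * b) + f a * b)
    (fun a a' b => by simp only [add_mul, map_add]; abel)
    (fun c a b => by simp [smul_sub, smul_add])
    (fun a b b' => by simp only [mul_add, map_add]; abel)
    (fun c a b => by simp [smul_sub, smul_add])

variable {A} in
/-- `f` is a Hochschild 2-coboundary, i.e. lies in `B²(A, A)`. -/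
def IsHochschildCoboundary (f : A →ₗ[ℂ] A →ₗ[ℂ] A) : Prop :=
  ∃ g : A →ₗ[ℂ] A, f = hochschildD g

variable {A} in
/-- The `ℂ[[t]]`-bilinear extension to `A[[t]]` of `m(a, b) = ∑ t^k m_k(a, b)`. -/
def extendedMul (m : ℕ → A →ₗ[ℂ] A →ₗ[ℂ] A) (f g : A⟦X⟧) : A⟦X⟧ :=
  PowerSeries.mk fun n =>
    ∑ p ∈ Finset.HasAntidiagonal.antidiagonal n,
      ∑ q ∈ Finset.HasAntidiagonal.antidiagonal p.2,
        m p.1 (PowerSeries.coeff q.1 f) (PowerSeries.coeff q.2 g)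

/-- A formal deformation `m(a, b) = a b + ∑_{k ≥ 1} t^k m_k(a, b)` of the algebra `A`: bilinear maps
`m_k` for which the product `m` on `A[[t]]` is associative. -/
@[ext]
structure FormalDeformation where
  coeff : ℕ → A →ₗ[ℂ] A →ₗ[ℂ] A
  coeff_zero : coeff 0 = LinearMap.mul ℂ A
  assoc : ∀ f g h : A⟦X⟧,
    extendedMul coeff (extendedMul coeff f g) h = extendedMul coeff f (extendedMul coeff g h)

variable {A} in
/-- `m` is infinitesimally trivial: there is a linear `θ₁` such that `θ = id + t θ₁` satisfies
`θ(a b) = m(θ a, θ b)` modulo `t²`. -/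
def FormalDeformation.InfinitesimallyTrivial (m : FormalDeformation A) : Prop :=
  ∃ θ₁ : A →ₗ[ℂ] A, ∀ a b : A, ∀ n < 2,
    PowerSeries.coeff n (PowerSeries.C (a * b) + PowerSeries.C (θ₁ (a * b)) * PowerSeries.X) =
    PowerSeries.coeff n (extendedMul m.coeff
      (PowerSeries.C a + PowerSeries.C (θ₁ a) * PowerSeries.X)
      (PowerSeries.C b + PowerSeries.C (θ₁ b) * PowerSeries.X))

end Deformation

/-- `m` is the deformation of the classical family algebra given by the star-products: for all
`a, b` in it, `a *_t b` is the polynomial `∑ t^k m_k(a, b)` in `t`. -/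
def IsStarDeformation {𝔤 : Type*} [LieRing 𝔤] [LieAlgebra ℂ 𝔤] [FiniteDimensional ℂ 𝔤]
    {V : Type*} [AddCommGroup V] [Module ℂ V] [FiniteDimensional ℂ V]
    [LieRingModule 𝔤 V] [LieModule ℂ 𝔤 V]
    (m : FormalDeformation (classicalFamilyAlgebra 𝔤 V)) : Prop :=
  ∀ a b : classicalFamilyAlgebra 𝔤 V, ∃ N : ℕ, (∀ k, N ≤ k → m.coeff k a b = 0) ∧
    ∀ t : ℂ, starProduct t (a : ClassicalMatrix 𝔤 V) (b : ClassicalMatrix 𝔤 V) =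
      ∑ k ∈ Finset.range N, t ^ k • (m.coeff k a b : ClassicalMatrix 𝔤 V)

end
end FamilyAlgebra

/-! The core is an explicit model of `U_t(𝔤)` on polynomials. For `x ∈ 𝔤` let `W_k(x)` be the
differential operator on `S(𝔤)` obtained from the polynomial vector field `y ↦ (ad y)^k x` by
reading `y` as the symbol of differentiation (`adOp`). The series `∑ (B_k / k!) t^k W_k(x)` (`gutt`)
satisfies the defining relation of `U_t(𝔤)`. This is `gutt_commutator`, which reduces to the
functional equation of `z / (e^z - 1)`. Since `W_k(x)` lowers the degree by `k - 1` and kills low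
degrees, the series can be evaluated at every complex `t` and gives a representation `guttRep` of
`U_t(𝔤)` on `S(𝔤)`. For `k ≥ 1` the operator `W_k(x)` kills powers of `x`, so `ι x ^ n` sends `1` to
`x ^ n`. As powers span `S(𝔤)`, acting on `1` inverts the symmetrization map on the left, which
gives injectivity (`guttRep_pbw_one`). Surjectivity is the usual filtration argument.

Consequently `a *_t b` on `S(𝔤)` is the action of `pbw a` on `b`, a polynomial in `t`. Its
coefficients define the `m_k`. Polynomials with vector coefficients determine their coefficients,
and these stay in any subspace containing all the values. This yields uniqueness, associativity
order by order, and preservation of the invariants, since `F_t` is equivariant. From `B_1 = -1/2`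
and `W_1(x) = -{x, ·}` one reads off `m_1 = P / 2`.

For the coboundary, put `D = ∑ τ(X_j) ⊗ ∂^j` (`diracOp`), which commutes with `G`. Differentiating
the invariance of `a` along `exp(s x)` gives `a τ(x) - τ(x) a = {x, a}` (`commutator_eq_poisson`).
Substituting this into `P(a, b) = -∑ {X_j, a} ∂^j b` and using the product rule for `∂^j` gives `P =
-dD` on invariants. Hence `m_1 = d(-D/2)`, and `θ₁ = D/2` trivializes the deformation modulo `t²`.
-/

namespace FamilyAlgebra
noncomputable section

/-! ### Constant coefficient differential operators on the symmetric algebra. -/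

section PartialDeriv

variable {W : Type*} [AddCommGroup W] [Module ℂ W] {κ : Type*} (X : Module.Basis κ ℂ W)

theorem partialDeriv_mul (i : κ) (a b : SymmetricAlgebra ℂ W) :
    partialDeriv X i (a * b) = partialDeriv X i a * b + a * partialDeriv X i b := by
  simp [partialDeriv, add_comm, mul_comm b]

theorem partialDeriv_algebraMap (i : κ) (c : ℂ) :
    partialDeriv X i (algebraMap ℂ (SymmetricAlgebra ℂ W) c) = 0 := by
  simp [partialDeriv]

theorem partialDeriv_one (i : κ) : partialDeriv X i (1 : SymmetricAlgebra ℂ W) = 0 := by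
  simp [partialDeriv]

theorem partialDeriv_ι (i : κ) (x : W) :
    partialDeriv X i (SymmetricAlgebra.ι ℂ W x) = algebraMap ℂ _ (X.coord i x) := by
  classical
  have : partialDeriv X i ∘ₗ SymmetricAlgebra.ι ℂ W =
      Algebra.linearMap ℂ (SymmetricAlgebra ℂ W) ∘ₗ X.coord i := by
    refine X.ext fun j => ?_
    simp [partialDeriv, Finsupp.single_apply, Pi.single_apply]
  exact congrArg (fun f => f x) this

theorem partialDeriv_pow_ι (i : κ) (x : W) (n : ℕ) :
    partialDeriv X i (SymmetricAlgebra.ι ℂ W x ^ (n + 1)) =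
      (((n : ℂ) + 1) * X.coord i x) • SymmetricAlgebra.ι ℂ W x ^ n := by
  induction n with
  | zero => simp [partialDeriv_ι, Algebra.algebraMap_eq_smul_one]
  | succ n ih =>
    rw [pow_succ, partialDeriv_mul, ih, partialDeriv_ι, Algebra.algebraMap_eq_smul_one]
    simp only [smul_mul_assoc, mul_smul_comm, mul_one, ← pow_succ, ← add_smul]
    congr 1
    push_cast
    ring

theorem partialDeriv_comm (i j : κ) (a : SymmetricAlgebra ℂ W) :
    partialDeriv X i (partialDeriv X j a) = partialDeriv X j (partialDeriv X i a) := by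
  induction a using SymmetricAlgebra.induction with
  | algebraMap r => simp [partialDeriv_algebraMap]
  | ι x => simp [partialDeriv_ι, partialDeriv_algebraMap]
  | mul a b ha hb => simp only [partialDeriv_mul, map_add, ha, hb]; ring
  | add a b ha hb => simp only [map_add, ha, hb]

open scoped IsMulCommutative in
/-- The constant coefficient differential operators on `S(W)`: the symbol `X_i` acts by `∂^i`. -/
def diffOp : MvPolynomial κ ℂ →ₐ[ℂ] Module.End ℂ (SymmetricAlgebra ℂ W) :=
  letI s : Set (Module.End ℂ (SymmetricAlgebra ℂ W)) := Set.range (partialDeriv X)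
  -- Evaluating a polynomial needs a commutative target, so it is done in the subalgebra generated
  -- by the commuting partial derivatives.
  haveI : IsMulCommutative (Algebra.adjoin ℂ s) := Algebra.isMulCommutative_adjoin ℂ (by
    rintro _ ⟨i, rfl⟩ _ ⟨j, rfl⟩
    exact LinearMap.ext fun a => partialDeriv_comm X i j a)
  (Algebra.adjoin ℂ s).val.comp
    (MvPolynomial.aeval (S₁ := Algebra.adjoin ℂ s) fun i => ⟨partialDeriv X i, Algebra.subset_adjoin ⟨i, rfl⟩⟩)

theorem diffOp_X (i : κ) : diffOp X (MvPolynomial.X i) = partialDeriv X i := by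
  simp [diffOp]

/-- The derivative of symbols in the direction `z`. -/
def symbolDeriv (z : W) : Derivation ℂ (MvPolynomial κ ℂ) (MvPolynomial κ ℂ) :=
  MvPolynomial.mkDerivation ℂ fun i => MvPolynomial.C (X.coord i z)

theorem symbolDeriv_X (z : W) (i : κ) :
    symbolDeriv X z (MvPolynomial.X i) = MvPolynomial.C (X.coord i z) := by
  simp [symbolDeriv]

theorem symbolDeriv_add (z z' : W) (r : MvPolynomial κ ℂ) :
    symbolDeriv X (z + z') r = symbolDeriv X z r + symbolDeriv X z' r := by
  have : symbolDeriv X (z + z') = symbolDeriv X z + symbolDeriv X z' :=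
    MvPolynomial.derivation_ext fun i => by simp [symbolDeriv_X]
  rw [this, Derivation.add_apply]

theorem symbolDeriv_smul (c : ℂ) (z : W) (r : MvPolynomial κ ℂ) :
    symbolDeriv X (c • z) r = c • symbolDeriv X z r := by
  have : symbolDeriv X (c • z) = c • symbolDeriv X z :=
    MvPolynomial.derivation_ext fun i => by simp [symbolDeriv_X, MvPolynomial.smul_eq_C_mul]
  rw [this, Derivation.smul_apply]

/-- Multiplication by `x` on `S(W)`. -/
abbrev mulι (x : W) : Module.End ℂ (SymmetricAlgebra ℂ W) :=
  LinearMap.mulLeft ℂ (SymmetricAlgebra.ι ℂ W x)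

theorem mulι_mul_mulι (x z : W) : mulι x * mulι z = mulι z * mulι x := by
  ext a
  simp only [Module.End.mul_apply, LinearMap.mulLeft_apply]
  ring

/-- The Heisenberg relation `[∂^i, z] = z_i`, extended from the generators to all symbols by the
product rule. -/
theorem diffOp_mul_mulι (r : MvPolynomial κ ℂ) (z : W) :
    diffOp X r * mulι z = mulι z * diffOp X r + diffOp X (symbolDeriv X z r) := by
  induction r using MvPolynomial.induction_on with
  | C c =>
    rw [show MvPolynomial.C c = algebraMap ℂ (MvPolynomial κ ℂ) c from rfl, Derivation.map_algebraMap,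
      AlgHom.commutes, map_zero, add_zero, Algebra.commutes]
  | add p q hp hq => simp only [map_add, add_mul, mul_add, hp, hq]; abel
  | mul_X p i hp =>
    have h : partialDeriv X i * mulι z =
        mulι z * partialDeriv X i + algebraMap ℂ (Module.End ℂ (SymmetricAlgebra ℂ W)) (X.coord i z) := by
      ext a
      simp [partialDeriv_mul, partialDeriv_ι, Algebra.smul_def]
      ring
    have h' : diffOp X (MvPolynomial.C (X.coord i z)) =
        algebraMap ℂ (Module.End ℂ (SymmetricAlgebra ℂ W)) (X.coord i z) :=
      (diffOp X).commutes _
    rw [Derivation.leibniz, symbolDeriv_X, map_mul, diffOp_X, mul_assoc, h, mul_add, ← mul_assoc, hp,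
      smul_eq_mul, smul_eq_mul, map_add, map_mul, mul_comm (MvPolynomial.X i), map_mul, diffOp_X, h']
    noncomm_ring

end PartialDeriv

/-! ### Polynomial vector fields on `𝔤` as operators on `S(𝔤)`, and the fields `(ad y)^k x`. -/

section WeylSymbols

variable {𝔤 : Type*} [LieRing 𝔤] [LieAlgebra ℂ 𝔤] {κ : Type*} (X : Module.Basis κ ℂ 𝔤)

/-- The operator with polynomial coefficients of degree one `r ⊗ x ↦ x · r(∂)` on `S(𝔤)`. -/
def vectorFieldOp :
    MvPolynomial κ ℂ ⊗[ℂ] 𝔤 →ₗ[ℂ] Module.End ℂ (SymmetricAlgebra ℂ 𝔤) :=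
  TensorProduct.lift (((LinearMap.mul ℂ (Module.End ℂ (SymmetricAlgebra ℂ 𝔤))).compl₁₂
    (LinearMap.mul ℂ (SymmetricAlgebra ℂ 𝔤) ∘ₗ SymmetricAlgebra.ι ℂ 𝔤) (diffOp X).toLinearMap).flip)

theorem vectorFieldOp_tmul (r : MvPolynomial κ ℂ) (x : 𝔤) :
    vectorFieldOp X (r ⊗ₜ x) = mulι x * diffOp X r := rfl

/-- The flat connection `∇_{s ⊗ z} (r ⊗ x) = s ∂_z r ⊗ x` on vector fields with polynomial
coefficients. -/
def flatConnection :
    (MvPolynomial κ ℂ ⊗[ℂ] 𝔤) →ₗ[ℂ] (MvPolynomial κ ℂ ⊗[ℂ] 𝔤) →ₗ[ℂ] (MvPolynomial κ ℂ ⊗[ℂ] 𝔤) :=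
  TensorProduct.lift (LinearMap.mk₂ ℂ
    (fun s z => LinearMap.rTensor 𝔤 (LinearMap.mulLeft ℂ s ∘ₗ (symbolDeriv X z).toLinearMap))
    (fun s s' z => by
      rw [← LinearMap.rTensor_add]
      congr 1
      ext r
      simp [add_mul])
    (fun c s z => by
      rw [← LinearMap.rTensor_smul]
      congr 1
      ext r
      simp)
    (fun s z z' => by
      rw [← LinearMap.rTensor_add]
      congr 1
      refine LinearMap.ext fun r => ?_
      simp [symbolDeriv_add, mul_add])
    (fun c s z => by
      rw [← LinearMap.rTensor_smul]
      congr 1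
      refine LinearMap.ext fun r => ?_
      simp [symbolDeriv_smul]))

theorem flatConnection_tmul (s r : MvPolynomial κ ℂ) (z x : 𝔤) :
    flatConnection X (s ⊗ₜ z) (r ⊗ₜ x) = (s * symbolDeriv X z r) ⊗ₜ x := rfl

/-- In `x r(∂) z s(∂)` the part `x z (r s)(∂)` is symmetric and cancels in the commutator. What
remains is the commutator of vector fields, in reversed order, written with the flat torsion-free
connection. -/
theorem vectorFieldOp_mul_sub (v w : MvPolynomial κ ℂ ⊗[ℂ] 𝔤) :
    vectorFieldOp X v * vectorFieldOp X w - vectorFieldOp X w * vectorFieldOp X v =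
      vectorFieldOp X (flatConnection X w v - flatConnection X v w) := by
  induction v with
  | zero => simp
  | add v v' hv hv' =>
    calc _ = (vectorFieldOp X v * vectorFieldOp X w - vectorFieldOp X w * vectorFieldOp X v) +
          (vectorFieldOp X v' * vectorFieldOp X w - vectorFieldOp X w * vectorFieldOp X v') := by
            simp only [map_add, add_mul, mul_add]; abel
      _ = _ := by rw [hv, hv']; simp only [map_add, map_sub, LinearMap.add_apply]; abel
  | tmul r x =>
  induction w with
  | zero => simp
  | add w w' hw hw' =>
    calc _ = (vectorFieldOp X (r ⊗ₜ x) * vectorFieldOp X w -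
            vectorFieldOp X w * vectorFieldOp X (r ⊗ₜ x)) +
          (vectorFieldOp X (r ⊗ₜ x) * vectorFieldOp X w' -
            vectorFieldOp X w' * vectorFieldOp X (r ⊗ₜ x)) := by
            simp only [map_add, add_mul, mul_add]; abel
      _ = _ := by rw [hw, hw']; simp only [map_add, map_sub, LinearMap.add_apply]; abel
  | tmul s z =>
    have h : ∀ (r s : MvPolynomial κ ℂ) (x z : 𝔤), mulι x * diffOp X r * (mulι z * diffOp X s) =
        mulι x * mulι z * diffOp X (r * s) + mulι x * diffOp X (s * symbolDeriv X z r) := by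
      intro r s x z
      rw [mul_assoc, ← mul_assoc (diffOp X r), diffOp_mul_mulι, map_mul, mul_comm s, map_mul]
      noncomm_ring
    rw [flatConnection_tmul, flatConnection_tmul, map_sub]
    simp only [vectorFieldOp_tmul]
    rw [h, h, mulι_mul_mulι z x, mul_comm s r]
    abel

/-- The bracket `⁅r ⊗ x, s ⊗ z⁆ = r s ⊗ ⁅x, z⁆`, bilinear over the polynomials. -/
def currentBracket : (MvPolynomial κ ℂ ⊗[ℂ] 𝔤) →ₗ[MvPolynomial κ ℂ] (MvPolynomial κ ℂ ⊗[ℂ] 𝔤)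
    →ₗ[MvPolynomial κ ℂ] (MvPolynomial κ ℂ ⊗[ℂ] 𝔤) :=
  LinearMap.mk₂ (MvPolynomial κ ℂ) (fun u v => ⁅u, v⁆) LieRing.add_lie
    (LieModule.smul_lie (R := MvPolynomial κ ℂ) (L := MvPolynomial κ ℂ ⊗[ℂ] 𝔤)
      (M := MvPolynomial κ ℂ ⊗[ℂ] 𝔤))
    LieRing.lie_add
    (LieAlgebra.lie_smul (R := MvPolynomial κ ℂ) (L := MvPolynomial κ ℂ ⊗[ℂ] 𝔤))

theorem currentBracket_tmul (r s : MvPolynomial κ ℂ) (x z : 𝔤) :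
    currentBracket (r ⊗ₜ x) (s ⊗ₜ z) = (r * s) ⊗ₜ ⁅x, z⁆ := rfl

theorem currentBracket_skew (u v : MvPolynomial κ ℂ ⊗[ℂ] 𝔤) :
    currentBracket u v = -currentBracket v u :=
  (lie_skew (L := MvPolynomial κ ℂ ⊗[ℂ] 𝔤) u v).symm

theorem currentBracket_leibniz (u v w : MvPolynomial κ ℂ ⊗[ℂ] 𝔤) :
    currentBracket u (currentBracket v w) =
      currentBracket (currentBracket u v) w + currentBracket v (currentBracket u w) :=
  LieRing.leibniz_lie u v w

/-- The bracket of `𝔤` has constant coefficients, so differentiating it is just the product rule. -/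
theorem flatConnection_currentBracket (w u v : MvPolynomial κ ℂ ⊗[ℂ] 𝔤) :
    flatConnection X w (currentBracket u v) =
      currentBracket (flatConnection X w u) v + currentBracket u (flatConnection X w v) := by
  induction w with
  | zero => simp
  | add w w' hw hw' => simp only [map_add, LinearMap.add_apply, hw, hw']; abel
  | tmul s z =>
  induction u with
  | zero => simp
  | add u u' hu hu' => simp only [LinearMap.add_apply, map_add, hu, hu']; abel
  | tmul r x =>
  induction v with
  | zero => simp
  | add v v' hv hv' => simp only [map_add, hv, hv']; abel
  | tmul r' x' =>
    simp only [flatConnection_tmul, currentBracket_tmul, ← TensorProduct.add_tmul,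
      Derivation.leibniz, smul_eq_mul]
    congr 1
    ring

theorem vectorFieldOp_X_smul (i : κ) (v : MvPolynomial κ ℂ ⊗[ℂ] 𝔤) :
    vectorFieldOp X ((MvPolynomial.X i : MvPolynomial κ ℂ) • v) =
      vectorFieldOp X v * partialDeriv X i := by
  induction v with
  | zero => simp
  | add v v' hv hv' => simp only [smul_add, map_add, hv, hv', add_mul]
  | tmul r x =>
    rw [TensorProduct.smul_tmul', vectorFieldOp_tmul, vectorFieldOp_tmul, smul_eq_mul, mul_comm,
      map_mul, diffOp_X, mul_assoc]

variable [Fintype κ]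

/-- The generic element `∑ X_i ⊗ X_i`, i.e. the Euler vector field. -/
def genericElement : MvPolynomial κ ℂ ⊗[ℂ] 𝔤 := ∑ i, MvPolynomial.X i ⊗ₜ[ℂ] X i

/-- The generic element is the identity map `y ↦ y`, whose derivative along `w` is `w`. -/
theorem flatConnection_genericElement (w : MvPolynomial κ ℂ ⊗[ℂ] 𝔤) :
    flatConnection X w (genericElement X) = w := by
  induction w with
  | zero => simp
  | add w w' hw hw' => simp only [map_add, LinearMap.add_apply, hw, hw']
  | tmul s z =>
    conv_rhs => rw [← X.sum_repr z, TensorProduct.tmul_sum]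
    simp [genericElement, flatConnection_tmul, symbolDeriv_X,
      mul_comm s, ← MvPolynomial.smul_eq_C_mul, TensorProduct.smul_tmul]

/-- The vector field `(ad y)^k x` in the variable `y ∈ 𝔤`. -/
def adField (k : ℕ) (x : 𝔤) : MvPolynomial κ ℂ ⊗[ℂ] 𝔤 :=
  (currentBracket (genericElement X) ^ k) (1 ⊗ₜ x)

theorem adField_zero (x : 𝔤) : adField X 0 x = 1 ⊗ₜ x := rfl

theorem adField_succ (k : ℕ) (x : 𝔤) :
    adField X (k + 1) x = currentBracket (genericElement X) (adField X k x) := by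
  rw [adField, pow_succ', Module.End.mul_apply, adField]

/-- The recursion from the innermost commutator. -/
theorem adField_succ' (k : ℕ) (x : 𝔤) :
    adField X (k + 1) x = ∑ i, (MvPolynomial.X i : MvPolynomial κ ℂ) • adField X k ⁅X i, x⁆ := by
  have h : currentBracket (genericElement X) (1 ⊗ₜ x) =
      ∑ i, (MvPolynomial.X i : MvPolynomial κ ℂ) • ((1 : MvPolynomial κ ℂ) ⊗ₜ[ℂ] ⁅X i, x⁆) := by
    simp [genericElement, currentBracket_tmul, TensorProduct.smul_tmul']
  rw [adField, pow_succ, Module.End.mul_apply, h, map_sum]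
  simp only [map_smul, adField]

/-- Differentiating `(ad y)^k x` along `w` replaces one of the `k` factors `ad y` by `ad w`; `p`
counts the factors to the right of it. -/
theorem flatConnection_adField (w : MvPolynomial κ ℂ ⊗[ℂ] 𝔤) (k : ℕ) (x : 𝔤) :
    flatConnection X w (adField X k x) = ∑ p ∈ Finset.range k,
      (currentBracket (genericElement X) ^ (k - 1 - p)) (currentBracket w (adField X p x)) := by
  induction k with
  | zero =>
    induction w with
    | zero => simp
    | add w w' hw hw' => simp only [map_add, LinearMap.add_apply, hw, hw']; simp
    | tmul s z => simp [adField_zero, flatConnection_tmul]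
  | succ k ih =>
    rw [adField_succ, flatConnection_currentBracket, flatConnection_genericElement, ih,
      Finset.sum_range_succ, map_sum, add_comm]
    congr 1
    · refine Finset.sum_congr rfl fun p hp => ?_
      rw [Finset.mem_range] at hp
      rw [← Module.End.mul_apply, ← pow_succ']
      congr 2
      omega
    · simp

/-- The operators `W_k(x)` on `S(𝔤)`: the differential operator with symbol `(ad y)^k x`. -/
def adOp (k : ℕ) : 𝔤 →ₗ[ℂ] Module.End ℂ (SymmetricAlgebra ℂ 𝔤) :=
  vectorFieldOp X ∘ₗ
    { toFun := adField X k
      map_add' := fun x z => by simp only [adField, TensorProduct.tmul_add, map_add]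
      map_smul' := fun c x => by
        simp only [adField, TensorProduct.tmul_smul, RingHom.id_apply]
        exact LinearMap.map_smul_of_tower _ c _ }

theorem adOp_apply (k : ℕ) (x : 𝔤) : adOp X k x = vectorFieldOp X (adField X k x) := rfl

theorem adOp_zero (x : 𝔤) : adOp X 0 x = mulι x := by
  rw [adOp_apply, adField_zero, vectorFieldOp_tmul, map_one, mul_one]

/-- The innermost commutator `⁅y, x⁆ = ∑ y_i ⁅X_i, x⁆` is expanded and the coordinate `y_i` becomes
`∂^i`. Each step consumes one derivative of `f`, which makes inductions on `k` possible. -/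
theorem adOp_succ (k : ℕ) (x : 𝔤) (f : SymmetricAlgebra ℂ 𝔤) :
    adOp X (k + 1) x f = ∑ i, adOp X k ⁅X i, x⁆ (partialDeriv X i f) := by
  rw [adOp_apply, adField_succ', map_sum, LinearMap.sum_apply]
  simp only [vectorFieldOp_X_smul]
  rfl

theorem adOp_one (x : 𝔤) (f : SymmetricAlgebra ℂ 𝔤) :
    adOp X 1 x f = - poisson X (SymmetricAlgebra.ι ℂ 𝔤 x) f := by
  classical
  rw [adOp_succ]
  simp only [poisson, LinearMap.sum_apply, LinearMap.compr₂_apply, LinearMap.compl₁₂_apply,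
    LinearMap.mul_apply', LinearMap.mulLeft_apply, partialDeriv_ι, adOp_zero]
  rw [Finset.sum_comm, ← Finset.sum_neg_distrib]
  refine Finset.sum_congr rfl fun j _ => ?_
  conv_lhs => rw [← X.sum_repr x]
  rw [lie_sum, map_sum, Finset.sum_mul, ← Finset.sum_neg_distrib]
  refine Finset.sum_congr rfl fun i _ => ?_
  rw [lie_smul, ← lie_skew, map_smul, Algebra.smul_def, map_neg, Module.Basis.coord_apply]
  ring

/-- Every derivative of `x ^ n` points along `x`: `∂^i` produces the factor `x_i`, and summing over
`i` turns the innermost commutator into `⁅x, x⁆ = 0`. -/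
theorem adOp_succ_pow (k n : ℕ) (x : 𝔤) :
    adOp X (k + 1) x (SymmetricAlgebra.ι ℂ 𝔤 x ^ n) = 0 := by
  rw [adOp_succ]
  cases n with
  | zero => simp [partialDeriv_one]
  | succ n =>
    have h : ∑ i, X.repr x i • adOp X k ⁅X i, x⁆ = 0 := by
      simp only [← map_smul, ← smul_lie]
      rw [← map_sum, ← sum_lie, X.sum_repr, lie_self, map_zero]
    have h' := congrArg (fun T => ((n : ℂ) + 1) • T (SymmetricAlgebra.ι ℂ 𝔤 x ^ n)) h
    simpa [partialDeriv_pow_ι, LinearMap.sum_apply, Finset.smul_sum, mul_smul] using h'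

/-- The elements of `S(𝔤)` killed by all partial derivatives of order `n`. -/
def derivFiltration {κ : Type*} (X : Module.Basis κ ℂ 𝔤) :
    ℕ → Submodule ℂ (SymmetricAlgebra ℂ 𝔤)
  | 0 => ⊥
  | n + 1 => ⨅ i, (derivFiltration X n).comap (partialDeriv X i)

/-- The operator `W_k(x)` contains `k` derivatives, so it kills polynomials of degree less than `k`.
-/
theorem exists_adOp_eq_zero (f : SymmetricAlgebra ℂ 𝔤) :
    ∃ n, ∀ k, n ≤ k → ∀ x, adOp X k x f = 0 := by
  classical
  -- `N n` consists of the polynomials of degree less than `n`, hence the shift by one: constants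
  -- lie in `N 1`.
  set N := derivFiltration X with hN
  have hsucc : ∀ n f, f ∈ N (n + 1) ↔ ∀ i, partialDeriv X i f ∈ N n := fun n f => by
    simp only [hN, derivFiltration, Submodule.mem_iInf, Submodule.mem_comap]
  have hmono : Monotone N := monotone_nat_of_le_succ fun n => by
    induction n with
    | zero => exact bot_le
    | succ n ih => exact fun f hf => (hsucc _ _).2 fun i => ih ((hsucc _ _).1 hf i)
  have hmul : ∀ n f (x : 𝔤), f ∈ N n → f * SymmetricAlgebra.ι ℂ 𝔤 x ∈ N (n + 1) := by
    intro n
    induction n with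
    | zero =>
      intro f x hf
      have : f = 0 := hf
      simp [this]
    | succ n ih =>
      intro f x hf
      rw [hsucc]
      intro i
      rw [partialDeriv_mul, partialDeriv_ι, ← Algebra.commutes, ← Algebra.smul_def]
      exact add_mem (ih _ x ((hsucc _ _).1 hf i)) (Submodule.smul_mem _ _ hf)
  have hex : ∀ f, ∃ n, f ∈ N n := by
    intro f
    obtain ⟨p, rfl⟩ := (SymmetricAlgebra.equivMvPolynomial X).symm.surjective f
    induction p using MvPolynomial.induction_on with
    | C c =>
      refine ⟨1, (hsucc _ _).2 fun i => ?_⟩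
      simp [partialDeriv]
    | add p q hp hq =>
      obtain ⟨n, hn⟩ := hp
      obtain ⟨m, hm⟩ := hq
      rw [map_add]
      exact ⟨max n m, add_mem (hmono (le_max_left _ _) hn) (hmono (le_max_right _ _) hm)⟩
    | mul_X p i hp =>
      obtain ⟨n, hn⟩ := hp
      rw [map_mul, SymmetricAlgebra.equivMvPolynomial_symm_X]
      exact ⟨n + 1, hmul n _ _ hn⟩
  have hzero : ∀ k f, f ∈ N k → ∀ x, adOp X k x f = 0 := by
    intro k
    induction k with
    | zero =>
      intro f hf x
      have : f = 0 := hf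
      simp [this]
    | succ k ih =>
      intro f hf x
      rw [adOp_succ]
      exact Finset.sum_eq_zero fun i _ => ih _ ((hsucc _ _).1 hf i) _
  obtain ⟨n, hn⟩ := hex f
  exact ⟨n, fun k hk => hzero k f (hmono hk hn)⟩

end WeylSymbols

/-! ### The functional equation of the Bernoulli generating function. -/

section Bernoulli

open PowerSeries in
/-- The functional equation of `z / (e^z - 1)`. -/
theorem bernoulliPowerSeries_rescale_add {K : Type*} [CommRing K] [IsDomain K] [Algebra ℚ K]
    {a b : K} (ha : a ≠ 0) (hb : b ≠ 0) :
    C b * rescale a (bernoulliPowerSeries K) *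
        (rescale (a + b) (bernoulliPowerSeries K) - rescale b (bernoulliPowerSeries K)) +
      C a * rescale b (bernoulliPowerSeries K) *
        (rescale (a + b) (bernoulliPowerSeries K) - rescale a (bernoulliPowerSeries K)) =
      -(C (a * b) * X * rescale (a + b) (bernoulliPowerSeries K)) := by
  have h : ∀ c : K, rescale c (bernoulliPowerSeries K) * (rescale c (exp K) - 1) = C c * X := by
    intro c
    have := congrArg (rescale c) (bernoulliPowerSeries_mul_exp_sub_one K)
    simpa [rescale_X] using this
  have hne : ∀ c : K, c ≠ 0 → rescale c (exp K) - 1 ≠ 0 := by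
    intro c hc h0
    have := h c
    rw [h0, mul_zero] at this
    exact mul_ne_zero ((map_ne_zero_iff _ (C_injective)).2 hc) X_ne_zero this.symm
  have hE := exp_mul_exp_eq_exp_add (A := K) a b
  have h1 := h a
  have h2 := h b
  have h3 := h (a + b)
  rw [← hE, map_add] at h3
  refine mul_right_cancel₀ (mul_ne_zero (hne a ha) (hne b hb)) ?_
  set p := rescale a (bernoulliPowerSeries K)
  set q := rescale b (bernoulliPowerSeries K)
  set r := rescale (a + b) (bernoulliPowerSeries K)
  set e := rescale a (exp K)
  set f := rescale b (exp K)
  rw [map_mul]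
  linear_combination (C b * r * (f - 1) - C b ^ 2 * X - C a * q * (f - 1)) * h1 +
    (C a * r * (e - 1) - C b * p * (e - 1) - C a ^ 2 * X) * h2 + C a * C b * X * h3

/-- The coefficients `B_n / n!` of `z / (e^z - 1)`. -/
def bernoulliCoeff (n : ℕ) : ℂ := ((bernoulli n / n.factorial : ℚ) : ℂ)

theorem bernoulliCoeff_zero : bernoulliCoeff 0 = 1 := by simp [bernoulliCoeff]

theorem bernoulliCoeff_one : bernoulliCoeff 1 = -(1 / 2) := by
  simp [bernoulliCoeff, bernoulli_one]; norm_num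

/-- The functional equation of `z / (e^z - 1)` in terms of coefficients. -/
theorem sum_bernoulliCoeff_smul (N : ℕ) :
    ∑ k ∈ Finset.HasAntidiagonal.antidiagonal (N + 1), (bernoulliCoeff k.1 * bernoulliCoeff k.2) •
      ((∑ p ∈ Finset.range k.1, (MvPolynomial.X 0 + MvPolynomial.X 1) ^ (k.1 - 1 - p) *
          (MvPolynomial.X 0 ^ p * MvPolynomial.X 1 ^ k.2)) +
        ∑ p ∈ Finset.range k.2, (MvPolynomial.X 0 + MvPolynomial.X 1) ^ (k.2 - 1 - p) *
          (MvPolynomial.X 0 ^ k.1 * MvPolynomial.X 1 ^ p)) =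
      -(bernoulliCoeff N • (MvPolynomial.X 0 + MvPolynomial.X 1 : MvPolynomial (Fin 2) ℂ) ^ N) := by
  set a : MvPolynomial (Fin 2) ℂ := MvPolynomial.X 0 with ha
  set b : MvPolynomial (Fin 2) ℂ := MvPolynomial.X 1 with hb
  have ha0 : a ≠ 0 := MvPolynomial.X_ne_zero _
  have hb0 : b ≠ 0 := MvPolynomial.X_ne_zero _
  have hc : ∀ n, PowerSeries.coeff n (bernoulliPowerSeries (MvPolynomial (Fin 2) ℂ)) =
      algebraMap ℂ _ (bernoulliCoeff n) := by
    intro n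
    simp only [bernoulliPowerSeries, PowerSeries.coeff_mk, bernoulliCoeff]
    rw [IsScalarTower.algebraMap_apply ℚ ℂ (MvPolynomial (Fin 2) ℂ)]
    rfl
  have key := congrArg (PowerSeries.coeff (N + 1)) (bernoulliPowerSeries_rescale_add ha0 hb0)
  -- Multiplying by `a b` turns the two geometric sums, which are difference quotients with
  -- denominators `b = (a + b) - a` and `a = (a + b) - b`, into differences of powers. The identity
  -- is then the coefficient of degree `N + 1` of the functional equation.
  refine mul_left_cancel₀ (mul_ne_zero ha0 hb0) ?_
  have hr : a * b * -(bernoulliCoeff N • (a + b) ^ N) = PowerSeries.coeff (N + 1)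
      (-(PowerSeries.C (a * b) * PowerSeries.X *
        PowerSeries.rescale (a + b) (bernoulliPowerSeries (MvPolynomial (Fin 2) ℂ)))) := by
    rw [map_neg, mul_assoc (PowerSeries.C (a * b)), PowerSeries.coeff_C_mul,
      PowerSeries.coeff_succ_X_mul, PowerSeries.coeff_rescale, hc, Algebra.smul_def]
    ring
  rw [hr, ← key, map_add, mul_assoc (PowerSeries.C b), mul_assoc (PowerSeries.C a), mul_assoc a,
    PowerSeries.coeff_C_mul, PowerSeries.coeff_C_mul,
    mul_comm (PowerSeries.rescale b _), PowerSeries.coeff_mul, PowerSeries.coeff_mul,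
    Finset.mul_sum, Finset.mul_sum, Finset.mul_sum, Finset.mul_sum, ← Finset.sum_add_distrib]
  refine Finset.sum_congr rfl fun k _ => ?_
  simp only [map_sub, PowerSeries.coeff_rescale, hc, Algebra.smul_def, map_mul]
  have h1 : a * ((∑ p ∈ Finset.range k.2, (a + b) ^ (k.2 - 1 - p) * (a ^ k.1 * b ^ p))) =
      a ^ k.1 * ((a + b) ^ k.2 - b ^ k.2) := by
    have := geom_sum₂_mul b (a + b) k.2
    rw [show b - (a + b) = -a by ring] at this
    have h' : ∑ p ∈ Finset.range k.2, (a + b) ^ (k.2 - 1 - p) * (a ^ k.1 * b ^ p) =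
        a ^ k.1 * ∑ p ∈ Finset.range k.2, b ^ p * (a + b) ^ (k.2 - 1 - p) := by
      rw [Finset.mul_sum]
      exact Finset.sum_congr rfl fun p _ => by ring
    rw [h']
    linear_combination (-a ^ k.1) * this
  have h2 : b * ((∑ p ∈ Finset.range k.1, (a + b) ^ (k.1 - 1 - p) * (a ^ p * b ^ k.2))) =
      b ^ k.2 * ((a + b) ^ k.1 - a ^ k.1) := by
    have := geom_sum₂_mul a (a + b) k.1
    rw [show a - (a + b) = -b by ring] at this
    have h' : ∑ p ∈ Finset.range k.1, (a + b) ^ (k.1 - 1 - p) * (a ^ p * b ^ k.2) =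
        b ^ k.2 * ∑ p ∈ Finset.range k.1, a ^ p * (a + b) ^ (k.1 - 1 - p) := by
      rw [Finset.mul_sum]
      exact Finset.sum_congr rfl fun p _ => by ring
    rw [h']
    linear_combination (-b ^ k.2) * this
  linear_combination (algebraMap ℂ (MvPolynomial (Fin 2) ℂ) (bernoulliCoeff k.1) * algebraMap ℂ
    (MvPolynomial (Fin 2) ℂ) (bernoulliCoeff k.2)) * (b * h1 + a * h2)

end Bernoulli

/-! ### The series `∑ (B_k / k!) t^k W_k(x)` satisfies the commutation relation of `U_t(𝔤)`. -/

section Commutator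

variable {𝔤 : Type*} [LieRing 𝔤] [LieAlgebra ℂ 𝔤] {κ : Type*} (X : Module.Basis κ ℂ 𝔤) [Fintype κ]

/-- The linear map `a^m b^n ↦ ⁅(ad y)^m x, (ad y)^n z⁆`. -/
def bracketMonomials (x z : 𝔤) : MvPolynomial (Fin 2) ℂ →ₗ[ℂ] MvPolynomial κ ℂ ⊗[ℂ] 𝔤 :=
  (MvPolynomial.basisMonomials (Fin 2) ℂ).constr ℂ fun s =>
    currentBracket (adField X (s 0) x) (adField X (s 1) z)

theorem bracketMonomials_monomial (x z : 𝔤) (s : Fin 2 →₀ ℕ) :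
    bracketMonomials X x z (MvPolynomial.monomial s 1) =
      currentBracket (adField X (s 0) x) (adField X (s 1) z) := by
  have h := congrFun (MvPolynomial.coe_basisMonomials (Fin 2) ℂ) s
  rw [bracketMonomials, ← h, Module.Basis.constr_basis]

theorem bracketMonomials_X_pow (x z : 𝔤) (m n : ℕ) :
    bracketMonomials X x z (MvPolynomial.X 0 ^ m * MvPolynomial.X 1 ^ n) =
      currentBracket (adField X m x) (adField X n z) := by
  rw [MvPolynomial.X_pow_eq_monomial, MvPolynomial.X_pow_eq_monomial, MvPolynomial.monomial_mul,
    one_mul, bracketMonomials_monomial]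
  simp

/-- By the Jacobi identity `ad y` is a derivation of the bracket: it raises either the power on `x`
or the power on `z`. Commutator computations thereby become identities between polynomials in two
commuting variables. -/
theorem bracketMonomials_add_mul (x z : 𝔤) (f : MvPolynomial (Fin 2) ℂ) :
    bracketMonomials X x z ((MvPolynomial.X 0 + MvPolynomial.X 1) * f) =
      currentBracket (genericElement X) (bracketMonomials X x z f) := by
  induction f using MvPolynomial.induction_on' with
  | add p q hp hq => simp only [mul_add _ p q, map_add, hp, hq]
  | monomial s c =>
    have hc : MvPolynomial.monomial s c = c • MvPolynomial.monomial s (1 : ℂ) := by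
      simp [MvPolynomial.smul_monomial]
    rw [hc, mul_smul_comm, map_smul, map_smul, LinearMap.map_smul_of_tower]
    congr 1
    rw [add_mul, map_add, MvPolynomial.X, MvPolynomial.X, MvPolynomial.monomial_mul,
      MvPolynomial.monomial_mul, one_mul, bracketMonomials_monomial, bracketMonomials_monomial,
      bracketMonomials_monomial, currentBracket_leibniz, ← adField_succ, ← adField_succ]
    simp [add_comm]

theorem bracketMonomials_pow_mul (x z : 𝔤) (n : ℕ) (f : MvPolynomial (Fin 2) ℂ) :
    bracketMonomials X x z ((MvPolynomial.X 0 + MvPolynomial.X 1) ^ n * f) =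
      (currentBracket (genericElement X) ^ n) (bracketMonomials X x z f) := by
  induction n with
  | zero => simp
  | succ n ih =>
    rw [pow_succ', mul_assoc, bracketMonomials_add_mul, ih, pow_succ', Module.End.mul_apply]

/-- Expanding the derivatives of `(ad y)^k` puts every term in the form `(ad y)^i ⁅(ad y)^m x, (ad
y)^n z⁆`, which encodes `(a + b)^i a^m b^n`. The sum is therefore the image of the polynomial
identity `sum_bernoulliCoeff_smul`. -/
theorem sum_flatConnection_adField (x z : 𝔤) (N : ℕ) :
    ∑ k ∈ Finset.HasAntidiagonal.antidiagonal (N + 1), (bernoulliCoeff k.1 * bernoulliCoeff k.2) •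
      (flatConnection X (adField X k.2 z) (adField X k.1 x) -
        flatConnection X (adField X k.1 x) (adField X k.2 z)) =
      bernoulliCoeff N • adField X N ⁅x, z⁆ := by
  have h := congrArg (bracketMonomials X x z) (sum_bernoulliCoeff_smul N)
  have h0 := bracketMonomials_pow_mul X x z N 1
  have h1 := bracketMonomials_X_pow X x z 0 0
  rw [pow_zero, pow_zero, one_mul] at h1
  rw [mul_one, h1, adField_zero, adField_zero, currentBracket_tmul, one_mul] at h0
  rw [map_neg, map_smul, h0, map_sum, neg_eq_iff_eq_neg.symm, ← Finset.sum_neg_distrib] at h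
  rw [adField, ← h]
  refine Finset.sum_congr rfl fun k _ => ?_
  rw [map_smul, map_add, map_sum, map_sum]
  refine Eq.trans ?_ (smul_neg _ _)
  rw [neg_add', flatConnection_adField,
    flatConnection_adField, ← Finset.sum_neg_distrib]
  simp only [bracketMonomials_pow_mul, bracketMonomials_X_pow]
  congr 2
  refine Finset.sum_congr rfl fun p _ => ?_
  rw [currentBracket_skew, map_neg]

/-- The power series `∑ (B_k / k!) t^k W_k(x)`: left multiplication by `x` for the star-product. -/
def gutt (x : 𝔤) : (Module.End ℂ (SymmetricAlgebra ℂ 𝔤))⟦X⟧ :=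
  PowerSeries.mk fun k => bernoulliCoeff k • adOp X k x

theorem coeff_gutt (k : ℕ) (x : 𝔤) :
    PowerSeries.coeff k (gutt X x) = bernoulliCoeff k • adOp X k x := PowerSeries.coeff_mk _ _

/-- Each coefficient of the commutator is an operator commutator of vector fields, so degree `N + 1`
is `sum_flatConnection_adField`. In degree zero the multiplications by `x` and `z` commute. -/
theorem gutt_commutator (x z : 𝔤) :
    gutt X x * gutt X z = gutt X z * gutt X x + PowerSeries.X * gutt X ⁅x, z⁆ := by
  rw [← sub_eq_iff_eq_add']
  ext1 N
  rw [map_sub, PowerSeries.coeff_mul, PowerSeries.coeff_mul,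
    ← Finset.Nat.sum_antidiagonal_swap (f := fun k =>
      PowerSeries.coeff k.1 (gutt X z) * PowerSeries.coeff k.2 (gutt X x)),
    ← Finset.sum_sub_distrib]
  simp only [Prod.fst_swap, Prod.snd_swap]
  have h : ∀ k : ℕ × ℕ, PowerSeries.coeff k.1 (gutt X x) * PowerSeries.coeff k.2 (gutt X z) -
      PowerSeries.coeff k.2 (gutt X z) * PowerSeries.coeff k.1 (gutt X x) =
      vectorFieldOp X ((bernoulliCoeff k.1 * bernoulliCoeff k.2) •
      (flatConnection X (adField X k.2 z) (adField X k.1 x) -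
        flatConnection X (adField X k.1 x) (adField X k.2 z))) := by
    intro k
    simp only [coeff_gutt]
    rw [map_smul, ← vectorFieldOp_mul_sub, smul_mul_smul_comm, smul_mul_smul_comm,
      mul_comm (bernoulliCoeff k.2)]
    exact (smul_sub _ _ _).symm
  simp only [h, ← map_sum]
  cases N with
  | zero =>
    rw [PowerSeries.coeff_zero_X_mul]
    simp only [Finset.Nat.antidiagonal_zero, Finset.sum_singleton, flatConnection_adField]
    simp
  | succ N =>
    rw [sum_flatConnection_adField, PowerSeries.coeff_succ_X_mul, coeff_gutt, map_smul]
    rfl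

end Commutator

/-! ### Polynomials with vector coefficients and evaluation of locally finite operator series. -/

section PolynomialFamilies

variable {M : Type*} [AddCommGroup M] [Module ℂ M]

/-- If a polynomial with vector coefficients has all its values in a subspace, then so are its
coefficients. -/
theorem coeff_mem_of_sum_pow_smul_mem (P : Submodule ℂ M) (v : ℕ → M) (N : ℕ)
    (h : ∀ t : ℂ, ∑ k ∈ Finset.range N, t ^ k • v k ∈ P) (k : ℕ) (hk : k < N) : v k ∈ P := by
  -- Passing to the quotient by `P` and testing against linear functionals leaves a scalar
  -- polynomial vanishing at every complex number.
  rw [← Submodule.Quotient.mk_eq_zero, ← Submodule.mkQ_apply, ← Module.forall_dual_apply_eq_zero_iff ℂ]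
  intro φ
  set p : Polynomial ℂ := ∑ k ∈ Finset.range N, Polynomial.monomial k (φ (P.mkQ (v k))) with hp
  have hp0 : p = 0 := Polynomial.funext fun t => by
    have h0 : P.mkQ (∑ k ∈ Finset.range N, t ^ k • v k) = 0 :=
      (Submodule.Quotient.mk_eq_zero P).2 (h t)
    have := congrArg φ h0
    simpa [hp, Polynomial.eval_finsetSum, mul_comm] using this
  have := congrArg (fun q => Polynomial.coeff q k) hp0
  simpa [hp, Polynomial.finsetSum_coeff, Polynomial.coeff_monomial, hk] using this

/-- The Cauchy product of polynomials with vector coefficients. -/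
theorem sum_pow_smul_sum_pow_smul (u : ℕ → ℕ → M) (N K : ℕ) (hN : ∀ i j, N ≤ i → u i j = 0)
    (hK : ∀ i j, K ≤ j → u i j = 0) (t : ℂ) :
    ∑ j ∈ Finset.range K, t ^ j • ∑ i ∈ Finset.range N, t ^ i • u i j =
      ∑ n ∈ Finset.range (N + K), t ^ n •
        ∑ p ∈ Finset.HasAntidiagonal.antidiagonal n, u p.1 p.2 := by
  simp only [Finset.smul_sum, smul_smul, ← pow_add]
  rw [Finset.sum_comm, ← Finset.sum_product', Finset.sum_sigma']
  refine Finset.sum_bij_ne_zero (fun p _ _ => ⟨p.1 + p.2, p⟩) ?_ ?_ ?_ ?_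
  · intro p hp _
    simp only [Finset.mem_product, Finset.mem_range] at hp
    simp only [Finset.mem_sigma, Finset.mem_range, Finset.HasAntidiagonal.mem_antidiagonal, and_true]
    omega
  · intro p _ _ q _ _ h
    simpa using (Sigma.mk.inj_iff.1 h).2
  · rintro ⟨n, p⟩ hp hne
    simp only [Finset.mem_sigma, Finset.mem_range, Finset.HasAntidiagonal.mem_antidiagonal] at hp
    have h1 : p.1 < N := by
      by_contra hc
      exact hne (by rw [hN _ _ (not_lt.1 hc), smul_zero])
    have h2 : p.2 < K := by
      by_contra hc
      exact hne (by rw [hK _ _ (not_lt.1 hc), smul_zero])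
    obtain ⟨_, rfl⟩ := hp
    refine ⟨p, by simp [h1, h2], ?_, rfl⟩
    rwa [add_comm p.2]
  · intro p _ _
    rw [add_comm p.2]

variable (M) in
/-- The power series of operators with only finitely many nonzero coefficients on each vector. -/
def locallyFiniteSeries : Subalgebra ℂ (Module.End ℂ M)⟦X⟧ where
  carrier := {F | ∀ b : M, ∃ N, ∀ k, N ≤ k → PowerSeries.coeff k F b = 0}
  mul_mem' := by
    intro F G hF hG b
    obtain ⟨K, hK⟩ := hG b
    choose N hN using fun j => hF (PowerSeries.coeff j G b)
    refine ⟨(Finset.range K).sup N + K, fun n hn => ?_⟩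
    rw [PowerSeries.coeff_mul, LinearMap.sum_apply]
    refine Finset.sum_eq_zero fun p hp => ?_
    rw [Finset.HasAntidiagonal.mem_antidiagonal] at hp
    rw [Module.End.mul_apply]
    rcases le_or_gt K p.2 with h | h
    · rw [hK _ h, map_zero]
    · have := Finset.le_sup (f := N) (Finset.mem_range.2 h)
      exact hN _ _ (by omega)
  add_mem' := by
    intro F G hF hG b
    obtain ⟨N, hN⟩ := hF b
    obtain ⟨K, hK⟩ := hG b
    refine ⟨max N K, fun k hk => ?_⟩
    rw [map_add, LinearMap.add_apply, hN k (le_of_max_le_left hk), hK k (le_of_max_le_right hk),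
      add_zero]
  algebraMap_mem' := by
    intro r b
    refine ⟨1, fun k hk => ?_⟩
    rw [PowerSeries.algebraMap_apply, PowerSeries.coeff_C, if_neg (by omega), LinearMap.zero_apply]

theorem finsum_pow_smul_coeff {F : (Module.End ℂ M)⟦X⟧} {b : M} {N : ℕ}
    (h : ∀ k, N ≤ k → PowerSeries.coeff k F b = 0) (t : ℂ) :
    ∑ᶠ k : ℕ, t ^ k • PowerSeries.coeff k F b =
      ∑ k ∈ Finset.range N, t ^ k • PowerSeries.coeff k F b := by
  refine finsum_eq_sum_of_support_subset _ fun k hk => ?_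
  rw [Finset.coe_range, Set.mem_Iio]
  by_contra hc
  exact hk (by simp [h k (not_lt.1 hc)])

/-- The value at `t` of a locally finite series of operators, as a linear map. -/
def evalSeriesAux (t : ℂ) (F : locallyFiniteSeries M) : Module.End ℂ M where
  toFun b := ∑ᶠ k : ℕ, t ^ k • PowerSeries.coeff k (F : (Module.End ℂ M)⟦X⟧) b
  map_add' b c := by
    obtain ⟨N, hN⟩ := F.2 b
    obtain ⟨K, hK⟩ := F.2 c
    rw [finsum_pow_smul_coeff (N := max N K) (fun k hk => by
        rw [map_add, hN k (le_of_max_le_left hk), hK k (le_of_max_le_right hk), add_zero]),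
      finsum_pow_smul_coeff (N := max N K) (fun k hk => hN k (le_of_max_le_left hk)),
      finsum_pow_smul_coeff (N := max N K) (fun k hk => hK k (le_of_max_le_right hk)),
      ← Finset.sum_add_distrib]
    simp only [map_add, smul_add]
  map_smul' c b := by
    obtain ⟨N, hN⟩ := F.2 b
    rw [finsum_pow_smul_coeff hN, finsum_pow_smul_coeff (N := N)
      (fun k hk => by rw [map_smul, hN k hk, smul_zero]), RingHom.id_apply, Finset.smul_sum]
    simp only [map_smul, smul_comm c]

theorem evalSeriesAux_apply (t : ℂ) (F : locallyFiniteSeries M) (b : M) {N : ℕ}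
    (h : ∀ k, N ≤ k → PowerSeries.coeff k (F : (Module.End ℂ M)⟦X⟧) b = 0) :
    evalSeriesAux t F b =
      ∑ k ∈ Finset.range N, t ^ k • PowerSeries.coeff k (F : (Module.End ℂ M)⟦X⟧) b :=
  finsum_pow_smul_coeff h t

theorem evalSeriesAux_mul (t : ℂ) (F G : locallyFiniteSeries M) :
    evalSeriesAux t (F * G) = evalSeriesAux t F * evalSeriesAux t G := by
  ext b
  obtain ⟨K, hK⟩ := G.2 b
  choose N' hN' using fun j => F.2 (PowerSeries.coeff j (G : (Module.End ℂ M)⟦X⟧) b)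
  set N := (Finset.range K).sup N'
  have hN : ∀ i j, N ≤ i → PowerSeries.coeff i (F : (Module.End ℂ M)⟦X⟧)
      (PowerSeries.coeff j (G : (Module.End ℂ M)⟦X⟧) b) = 0 := by
    intro i j hi
    rcases le_or_gt K j with h | h
    · rw [hK _ h, map_zero]
    · exact hN' _ _ ((Finset.le_sup (f := N') (Finset.mem_range.2 h)).trans hi)
  have hc : ∀ n, PowerSeries.coeff n ((F * G : locallyFiniteSeries M) : (Module.End ℂ M)⟦X⟧) b =
      ∑ p ∈ Finset.HasAntidiagonal.antidiagonal n, PowerSeries.coeff p.1 (F : (Module.End ℂ M)⟦X⟧)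
        (PowerSeries.coeff p.2 (G : (Module.End ℂ M)⟦X⟧) b) := by
    intro n
    rw [Subalgebra.coe_mul, PowerSeries.coeff_mul, LinearMap.sum_apply]
    rfl
  rw [Module.End.mul_apply, evalSeriesAux_apply t G b hK, map_sum,
    evalSeriesAux_apply t (F * G) b (N := N + K)]
  · simp only [hc, map_smul]
    rw [← sum_pow_smul_sum_pow_smul (fun i j => PowerSeries.coeff i (F : (Module.End ℂ M)⟦X⟧)
        (PowerSeries.coeff j (G : (Module.End ℂ M)⟦X⟧) b)) N K hN
        (fun i j hj => by rw [hK _ hj, map_zero])]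
    exact Finset.sum_congr rfl fun j _ => by rw [evalSeriesAux_apply t F _ fun i hi => hN i j hi]
  · intro n hn
    rw [hc]
    refine Finset.sum_eq_zero fun p hp => ?_
    rw [Finset.HasAntidiagonal.mem_antidiagonal] at hp
    rcases le_or_gt K p.2 with h | h
    · rw [hK _ h, map_zero]
    · exact hN _ _ (by omega)

/-- The value at `t` of a locally finite series of operators, as an algebra homomorphism. -/
def evalSeries (t : ℂ) : locallyFiniteSeries M →ₐ[ℂ] Module.End ℂ M :=
  AlgHom.ofLinearMap
    { toFun := evalSeriesAux t
      map_add' := fun F G => by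
        ext b
        obtain ⟨N, hN⟩ := F.2 b
        obtain ⟨K, hK⟩ := G.2 b
        rw [LinearMap.add_apply,
          evalSeriesAux_apply t F b (N := max N K) (fun k hk => hN k (le_of_max_le_left hk)),
          evalSeriesAux_apply t G b (N := max N K) (fun k hk => hK k (le_of_max_le_right hk)),
          evalSeriesAux_apply t (F + G) b (N := max N K) (fun k hk => by
            rw [Subalgebra.coe_add, map_add, LinearMap.add_apply, hN k (le_of_max_le_left hk),
              hK k (le_of_max_le_right hk), add_zero]), ← Finset.sum_add_distrib]
        simp only [Subalgebra.coe_add, map_add, LinearMap.add_apply, smul_add]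
      map_smul' := fun c F => by
        ext b
        obtain ⟨N, hN⟩ := F.2 b
        have hc : ∀ k, PowerSeries.coeff k ((c • F : locallyFiniteSeries M) : (Module.End ℂ M)⟦X⟧) b =
            c • PowerSeries.coeff k (F : (Module.End ℂ M)⟦X⟧) b := fun k => rfl
        rw [RingHom.id_apply, LinearMap.smul_apply, evalSeriesAux_apply t F b hN,
          evalSeriesAux_apply t (c • F) b (N := N) (fun k hk => by rw [hc, hN k hk, smul_zero]),
          Finset.smul_sum]
        simp only [hc, smul_comm c] }
    (by
      ext b
      change evalSeriesAux t 1 b = b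
      rw [evalSeriesAux_apply t 1 b (N := 1)]
      · simp
      · intro k hk
        simp [PowerSeries.coeff_one, show k ≠ 0 by omega])
    (evalSeriesAux_mul t)

theorem evalSeries_apply (t : ℂ) (F : locallyFiniteSeries M) (b : M) {N : ℕ}
    (h : ∀ k, N ≤ k → PowerSeries.coeff k (F : (Module.End ℂ M)⟦X⟧) b = 0) :
    evalSeries t F b =
      ∑ k ∈ Finset.range N, t ^ k • PowerSeries.coeff k (F : (Module.End ℂ M)⟦X⟧) b :=
  finsum_pow_smul_coeff h t

end PolynomialFamilies

/-- The symmetric algebra is spanned by the powers of the elements of degree one. -/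
theorem span_pow_ι (W : Type*) [AddCommGroup W] [Module ℂ W] :
    Submodule.span ℂ (Set.range fun p : W × ℕ => SymmetricAlgebra.ι ℂ W p.1 ^ p.2) = ⊤ := by
  set P := Submodule.span ℂ (Set.range fun p : W × ℕ => SymmetricAlgebra.ι ℂ W p.1 ^ p.2) with hP
  have hpow : ∀ (y : W) (n : ℕ), SymmetricAlgebra.ι ℂ W y ^ n ∈ P := fun y n =>
    Submodule.subset_span ⟨(y, n), rfl⟩
  have hι : ∀ (x y : W) (n : ℕ), SymmetricAlgebra.ι ℂ W x * SymmetricAlgebra.ι ℂ W y ^ n ∈ P := by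
    intro x y n
    -- Polarization: the coefficient of `t` in `(t x + y)^(n+1)` is `(n + 1) x y^n`, and all values
    -- of this polynomial are powers.
    have h := coeff_mem_of_sum_pow_smul_mem P (fun m => SymmetricAlgebra.ι ℂ W x ^ m *
      SymmetricAlgebra.ι ℂ W y ^ (n + 1 - m) * ((n + 1).choose m : SymmetricAlgebra ℂ W)) (n + 2)
      (fun t => by
        have := hpow (t • x + y) (n + 1)
        rw [map_add, map_smul, add_pow] at this
        simpa [smul_pow] using this) 1 (by omega)
    have h' : SymmetricAlgebra.ι ℂ W x ^ 1 * SymmetricAlgebra.ι ℂ W y ^ (n + 1 - 1) *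
        ((n + 1).choose 1 : SymmetricAlgebra ℂ W) = ((n + 1 : ℕ) : ℂ) •
          (SymmetricAlgebra.ι ℂ W x * SymmetricAlgebra.ι ℂ W y ^ n) := by
      rw [pow_one, Nat.choose_one_right, Nat.add_sub_cancel, mul_comm, ← nsmul_eq_mul,
        Nat.cast_smul_eq_nsmul]
    exact (P.smul_mem_iff (by exact_mod_cast Nat.succ_ne_zero n)).1 (h' ▸ h)
  have hmul : ∀ a p, p ∈ P → a * p ∈ P := by
    intro a
    induction a using SymmetricAlgebra.induction with
    | algebraMap r => exact fun p hp => by rw [← Algebra.smul_def]; exact P.smul_mem r hp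
    | ι x =>
      intro p hp
      induction hp using Submodule.span_induction with
      | mem p hp => obtain ⟨q, rfl⟩ := hp; exact hι _ _ _
      | zero => simp
      | add p q _ _ hp hq => rw [mul_add]; exact add_mem hp hq
      | smul c p _ hp => rw [mul_smul_comm]; exact P.smul_mem c hp
    | mul a b ha hb => exact fun p hp => by rw [mul_assoc]; exact ha _ (hb _ hp)
    | add a b ha hb => exact fun p hp => by rw [add_mul]; exact add_mem (ha _ hp) (hb _ hp)
  rw [eq_top_iff]
  intro a _
  have := hmul a _ (hpow 0 0)
  rwa [pow_zero, mul_one] at this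

/-! ### The representation of `U_t(𝔤)` on `S(𝔤)` and the Poincaré–Birkhoff–Witt theorem. -/

section PBW

variable {𝔤 : Type*} [LieRing 𝔤] [LieAlgebra ℂ 𝔤]

theorem gutt_mem {κ : Type*} (X : Module.Basis κ ℂ 𝔤) [Fintype κ] (x : 𝔤) :
    gutt X x ∈ locallyFiniteSeries (SymmetricAlgebra ℂ 𝔤) := by
  intro b
  obtain ⟨N, hN⟩ := exists_adOp_eq_zero X b
  exact ⟨N, fun k hk => by rw [coeff_gutt, LinearMap.smul_apply, hN k hk, smul_zero]⟩

section GuttRep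

variable {κ : Type*} (X : Module.Basis κ ℂ 𝔤) [Fintype κ]

/-- The Gutt series as a linear map from `𝔤`. -/
def guttSeries : 𝔤 →ₗ[ℂ] locallyFiniteSeries (SymmetricAlgebra ℂ 𝔤) where
  toFun x := ⟨gutt X x, gutt_mem X x⟩
  map_add' x z := by
    ext1
    ext1 k
    simp only [Subalgebra.coe_add, map_add, coeff_gutt, smul_add]
  map_smul' c x := by
    ext1
    ext1 k
    change PowerSeries.coeff k (gutt X (c • x)) = c • PowerSeries.coeff k (gutt X x)
    rw [coeff_gutt, coeff_gutt, map_smul, smul_comm]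

/-- Evaluation is multiplicative and sends the formal variable to the scalar `t`, so the formal
relation specializes. -/
theorem evalSeries_commutator (t : ℂ) (x z : 𝔤) :
    evalSeries t (guttSeries X x) * evalSeries t (guttSeries X z) =
      evalSeries t (guttSeries X z) * evalSeries t (guttSeries X x) +
        t • evalSeries t (guttSeries X ⁅x, z⁆) := by
  have hX : (PowerSeries.X : (Module.End ℂ (SymmetricAlgebra ℂ 𝔤))⟦X⟧) ∈
      locallyFiniteSeries (SymmetricAlgebra ℂ 𝔤) := fun b =>
    ⟨2, fun k hk => by rw [PowerSeries.coeff_X, if_neg (by omega), LinearMap.zero_apply]⟩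
  have hXt : evalSeries t ⟨PowerSeries.X, hX⟩ = algebraMap ℂ _ t := by
    ext b
    rw [evalSeries_apply t _ b (N := 2)
      fun k hk => by rw [PowerSeries.coeff_X, if_neg (by omega), LinearMap.zero_apply]]
    simp [Finset.sum_range_succ, PowerSeries.coeff_X, Algebra.algebraMap_eq_smul_one]
  have h : guttSeries X x * guttSeries X z = guttSeries X z * guttSeries X x +
      ⟨PowerSeries.X, hX⟩ * guttSeries X ⁅x, z⁆ := Subtype.ext (gutt_commutator X x z)
  rw [← map_mul, h, map_add, map_mul, map_mul, hXt, Algebra.smul_def]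

/-- The representation of `U_t(𝔤)` on `S(𝔤)`. -/
def guttRep (t : ℂ) : DeformedU 𝔤 t →ₐ[ℂ] Module.End ℂ (SymmetricAlgebra ℂ 𝔤) :=
  DeformedU.lift t ((evalSeries t).toLinearMap ∘ₗ guttSeries X) (evalSeries_commutator X t)

theorem guttRep_ι (t : ℂ) (x : 𝔤) :
    guttRep X t (DeformedU.ι t x) = evalSeries t (guttSeries X x) :=
  DeformedU.lift_ι _ _ _ _

theorem evalSeries_guttSeries_pow (t : ℂ) (x : 𝔤) (n : ℕ) :
    evalSeries t (guttSeries X x) (SymmetricAlgebra.ι ℂ 𝔤 x ^ n) =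
      SymmetricAlgebra.ι ℂ 𝔤 x ^ (n + 1) := by
  rw [evalSeries_apply t _ _ (N := 1)]
  · change ∑ k ∈ Finset.range 1, t ^ k • PowerSeries.coeff k (gutt X x) _ = _
    simp [coeff_gutt, adOp_zero, bernoulliCoeff_zero, pow_succ']
  · intro k hk
    obtain ⟨j, rfl⟩ := Nat.exists_eq_add_of_le' hk
    change PowerSeries.coeff (j + 1) (gutt X x) _ = 0
    rw [coeff_gutt, LinearMap.smul_apply, adOp_succ_pow, smul_zero]

variable [FiniteDimensional ℂ 𝔤]

theorem pbw_pow_ι (t : ℂ) (x : 𝔤) (n : ℕ) :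
    pbw 𝔤 t (SymmetricAlgebra.ι ℂ 𝔤 x ^ n) = DeformedU.ι t x ^ n := by
  have h := pbw_prod t n fun _ => x
  rw [Finset.prod_const, Finset.card_univ, Fintype.card_fin] at h
  rw [h]
  simp only [List.ofFn_const, List.prod_replicate, Finset.sum_const, Finset.card_univ,
    Fintype.card_perm, Fintype.card_fin]
  rw [← Nat.cast_smul_eq_nsmul ℂ, smul_smul, inv_mul_cancel₀ (by exact_mod_cast n.factorial_ne_zero),
    one_smul]

/-- It suffices to test powers, where symmetrization is the plain power `ι x ^ n` and each factor
multiplies the current power of `x` by `x`. -/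
theorem guttRep_pbw_one (t : ℂ) (a : SymmetricAlgebra ℂ 𝔤) :
    guttRep X t (pbw 𝔤 t a) 1 = a := by
  have h : a ∈ Submodule.span ℂ
      (Set.range fun p : 𝔤 × ℕ => SymmetricAlgebra.ι ℂ 𝔤 p.1 ^ p.2) := span_pow_ι 𝔤 ▸ trivial
  induction h using Submodule.span_induction with
  | mem a ha =>
    obtain ⟨⟨x, n⟩, rfl⟩ := ha
    simp only [pbw_pow_ι, map_pow, guttRep_ι]
    induction n with
    | zero => simp
    | succ n ih => rw [pow_succ', Module.End.mul_apply, ih, evalSeries_guttSeries_pow]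
  | zero => simp
  | add a b _ _ ha hb => rw [map_add, map_add, LinearMap.add_apply, ha, hb]
  | smul c a _ ha => rw [map_smul, map_smul, LinearMap.smul_apply, ha]

end GuttRep

/-- The span of the products of fewer than `n` elements of `𝔤` in `U_t(𝔤)`. -/
def productFiltration (𝔤 : Type*) [LieRing 𝔤] [LieAlgebra ℂ 𝔤] (t : ℂ) (n : ℕ) :
    Submodule ℂ (DeformedU 𝔤 t) :=
  Submodule.span ℂ {u | ∃ l : List 𝔤, l.length < n ∧ (l.map (DeformedU.ι t)).prod = u}

theorem ι_mul_mem_productFiltration {t : ℂ} {n : ℕ} (x : 𝔤) {u : DeformedU 𝔤 t}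
    (hu : u ∈ productFiltration 𝔤 t n) : DeformedU.ι t x * u ∈ productFiltration 𝔤 t (n + 1) := by
  induction hu using Submodule.span_induction with
  | mem u hu =>
    obtain ⟨l, hl, rfl⟩ := hu
    exact Submodule.subset_span ⟨x :: l, by simpa using hl, by simp⟩
  | zero => simp
  | add u v _ _ hu hv => rw [mul_add]; exact add_mem hu hv
  | smul c u _ hu => rw [mul_smul_comm]; exact Submodule.smul_mem _ c hu

/-- An adjacent transposition costs `t` times a product in which two factors are replaced by their
bracket, hence a shorter product. -/
theorem prod_sub_prod_mem_productFiltration (t : ℂ) {l l' : List 𝔤} (h : l.Perm l') :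
    (l.map (DeformedU.ι t)).prod - (l'.map (DeformedU.ι t)).prod ∈
      productFiltration 𝔤 t l.length := by
  induction h with
  | nil => simp
  | cons x h ih =>
    rw [List.map_cons, List.map_cons, List.prod_cons, List.prod_cons, ← mul_sub]
    exact ι_mul_mem_productFiltration x ih
  | swap x y l =>
    have h : (((y :: x :: l).map (DeformedU.ι t)).prod : DeformedU 𝔤 t) -
        ((x :: y :: l).map (DeformedU.ι t)).prod = t • ((⁅y, x⁆ :: l).map (DeformedU.ι t)).prod := by
      simp only [List.map_cons, List.prod_cons, ← mul_assoc, DeformedU.ι_mul_ι t y x, add_mul,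
        add_sub_cancel_left, smul_mul_assoc]
    rw [h]
    exact Submodule.smul_mem _ _ (Submodule.subset_span ⟨_, by simp, rfl⟩)
  | trans h h' ih ih' =>
    rw [← sub_add_sub_cancel]
    exact add_mem ih (h.length_eq ▸ ih')

/-- Induction on the length: a product differs from each of its reorderings, hence from their
average, by shorter products. That average lies in the range. -/
theorem pbw_surjective [FiniteDimensional ℂ 𝔤] (t : ℂ) : Function.Surjective (pbw 𝔤 t) := by
  have hlist : ∀ n (l : List 𝔤), l.length = n →
      (l.map (DeformedU.ι t)).prod ∈ LinearMap.range (pbw 𝔤 t) := by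
    intro n
    induction n using Nat.strong_induction_on with
    | _ n ih =>
    rintro l rfl
    have hF : productFiltration 𝔤 t l.length ≤ LinearMap.range (pbw 𝔤 t) := by
      refine Submodule.span_le.2 ?_
      rintro _ ⟨m, hm, rfl⟩
      exact ih _ hm m rfl
    have hp := pbw_prod t l.length l.get
    have hσ : ∀ σ : Equiv.Perm (Fin l.length), (l.map (DeformedU.ι t)).prod -
        (List.ofFn fun i => DeformedU.ι t (l.get (σ i))).prod ∈ LinearMap.range (pbw 𝔤 t) := by
      intro σ
      have h1 : (List.ofFn fun i => DeformedU.ι t (l.get (σ i))) =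
          (List.ofFn (l.get ∘ σ)).map (DeformedU.ι t) := by
        rw [List.map_ofFn]
        rfl
      rw [h1]
      refine hF (prod_sub_prod_mem_productFiltration t ?_)
      have := σ.ofFn_comp_perm l.get
      rw [List.ofFn_get] at this
      exact this.symm
    have hsum := Submodule.smul_mem _ ((l.length.factorial : ℂ)⁻¹) (sum_mem (t := Finset.univ) fun σ _ => hσ σ)
    have hf : (l.length.factorial : ℂ) ≠ 0 := by exact_mod_cast l.length.factorial_ne_zero
    rw [Finset.sum_sub_distrib, smul_sub, ← hp, Finset.sum_const, Finset.card_univ,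
      Fintype.card_perm, Fintype.card_fin, ← Nat.cast_smul_eq_nsmul ℂ, smul_smul,
      inv_mul_cancel₀ hf, one_smul] at hsum
    exact (Submodule.sub_mem_iff_left _ (LinearMap.mem_range_self _ _)).1 hsum
  -- The span of ordered products is stable under left multiplication by `U_t(𝔤)` and contains `1`,
  -- so it is everything.
  have hmul : ∀ (a : TensorAlgebra ℂ 𝔤) (u : DeformedU 𝔤 t),
      u ∈ Submodule.span ℂ (Set.range fun l : List 𝔤 => (l.map (DeformedU.ι t)).prod) →
      DeformedU.mk 𝔤 t a * u ∈
        Submodule.span ℂ (Set.range fun l : List 𝔤 => (l.map (DeformedU.ι t)).prod) := by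
    intro a
    induction a using TensorAlgebra.induction with
    | algebraMap r =>
      intro u hu
      rw [AlgHom.commutes, ← Algebra.smul_def]
      exact Submodule.smul_mem _ _ hu
    | ι x =>
      intro u hu
      induction hu using Submodule.span_induction with
      | mem u hu =>
        obtain ⟨l, rfl⟩ := hu
        exact Submodule.subset_span ⟨x :: l, by simp only [List.map_cons, List.prod_cons]; rfl⟩
      | zero => simp
      | add u v _ _ hu hv => rw [mul_add]; exact add_mem hu hv
      | smul c u _ hu => rw [mul_smul_comm]; exact Submodule.smul_mem _ c hu
    | mul a b ha hb => exact fun u hu => by rw [map_mul, mul_assoc]; exact ha _ (hb _ hu)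
    | add a b ha hb => exact fun u hu => by rw [map_add, add_mul]; exact add_mem (ha _ hu) (hb _ hu)
  intro u
  obtain ⟨a, rfl⟩ := RingQuot.mkAlgHom_surjective ℂ (DeformedRel 𝔤 t) u
  have h := hmul a 1 (Submodule.subset_span ⟨[], rfl⟩)
  rw [mul_one] at h
  refine (Submodule.span_le.2 ?_ : _ ≤ LinearMap.range (pbw 𝔤 t)) h
  rintro _ ⟨l, rfl⟩
  exact hlist _ l rfl

theorem pbw_bijective [FiniteDimensional ℂ 𝔤] (t : ℂ) : Function.Bijective (pbw 𝔤 t) :=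
  ⟨Function.LeftInverse.injective (g := fun u => guttRep (Module.finBasis ℂ 𝔤) t u 1)
    (guttRep_pbw_one _ t), pbw_surjective t⟩

end PBW

/-! ### Calculus of polynomial functions of `t` through their coefficients. -/

section HasCoeffs

variable {M M' : Type*} [AddCommGroup M] [Module ℂ M] [AddCommGroup M'] [Module ℂ M']

/-- The function `f` is the polynomial `∑ t^k c_k` with vector coefficients. -/
def HasCoeffs (f : ℂ → M) (c : ℕ → M) : Prop :=
  ∃ N : ℕ, (∀ k, N ≤ k → c k = 0) ∧ ∀ t : ℂ, f t = ∑ k ∈ Finset.range N, t ^ k • c k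

theorem sum_range_pow_smul_eq {c : ℕ → M} {N K : ℕ} (hN : ∀ k, N ≤ k → c k = 0) (h : N ≤ K) (t : ℂ) :
    ∑ k ∈ Finset.range N, t ^ k • c k = ∑ k ∈ Finset.range K, t ^ k • c k :=
  Finset.sum_subset (Finset.range_mono h) fun k _ hk => by
    rw [hN k (by simpa using hk), smul_zero]

namespace HasCoeffs

variable {f g : ℂ → M} {c d : ℕ → M}

theorem exists_large (h : HasCoeffs f c) : ∃ N : ℕ, ∀ K, N ≤ K → (∀ k, K ≤ k → c k = 0) ∧
    ∀ t : ℂ, f t = ∑ k ∈ Finset.range K, t ^ k • c k := by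
  obtain ⟨N, hN, hf⟩ := h
  exact ⟨N, fun K hK => ⟨fun k hk => hN k (hK.trans hk), fun t =>
    (hf t).trans (sum_range_pow_smul_eq hN hK t)⟩⟩

theorem zero : HasCoeffs (fun _ => (0 : M)) 0 := ⟨0, fun _ _ => rfl, fun _ => by simp⟩

theorem add (hf : HasCoeffs f c) (hg : HasCoeffs g d) : HasCoeffs (fun t => f t + g t) (c + d) := by
  obtain ⟨N, hN⟩ := hf.exists_large
  obtain ⟨K, hK⟩ := hg.exists_large
  obtain ⟨h1, h2⟩ := hN (max N K) (le_max_left _ _)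
  obtain ⟨h3, h4⟩ := hK (max N K) (le_max_right _ _)
  refine ⟨max N K, fun k hk => by rw [Pi.add_apply, h1 k hk, h3 k hk, add_zero], fun t => ?_⟩
  simp only [h2, h4, Pi.add_apply, smul_add, Finset.sum_add_distrib]

theorem map (hf : HasCoeffs f c) (L : M →ₗ[ℂ] M') :
    HasCoeffs (fun t => L (f t)) (fun k => L (c k)) := by
  obtain ⟨N, h1, h2⟩ := hf
  exact ⟨N, fun k hk => by simp only [h1 k hk, map_zero], fun t => by simp [h2]⟩

theorem smul (hf : HasCoeffs f c) (z : ℂ) : HasCoeffs (fun t => z • f t) (z • c) :=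
  hf.map (LinearMap.lsmul ℂ M z)

theorem mem (hf : HasCoeffs f c) (P : Submodule ℂ M) (h : ∀ t, f t ∈ P) (k : ℕ) : c k ∈ P := by
  obtain ⟨N, h1, h2⟩ := hf
  rcases le_or_gt N k with hk | hk
  · rw [h1 k hk]
    exact P.zero_mem
  · exact coeff_mem_of_sum_pow_smul_mem P c N (fun t => h2 t ▸ h t) k hk

theorem unique (hc : HasCoeffs f c) (hd : HasCoeffs f d) : c = d := by
  funext k
  have := (hc.add (hd.smul (-1))).mem ⊥ (fun t => by simp) k
  simpa [add_neg_eq_zero] using this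

/-- The Cauchy product. A single bound on the degree of `B t` exists because only finitely many
coefficients of `f` are nonzero. -/
theorem comp {B : ℂ → M →ₗ[ℂ] M'} {b : ℕ → M →ₗ[ℂ] M'}
    (hB : ∀ x, HasCoeffs (fun t => B t x) (fun k => b k x)) (hf : HasCoeffs f c) :
    HasCoeffs (fun t => B t (f t)) (fun n =>
      ∑ p ∈ Finset.HasAntidiagonal.antidiagonal n, b p.1 (c p.2)) := by
  obtain ⟨K, hK, hfK⟩ := hf
  choose N' hN' using fun j => (hB (c j)).exists_large
  set N := (Finset.range K).sup N'
  have hle : ∀ j, j < K → N' j ≤ N := fun j hj => Finset.le_sup (f := N') (Finset.mem_range.2 hj)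
  have hzero : ∀ i j, N ≤ i → b i (c j) = 0 := by
    intro i j hi
    rcases le_or_gt K j with h | h
    · rw [hK _ h, map_zero]
    · exact (hN' j N (hle j h)).1 i hi
  have hzero' : ∀ i j, K ≤ j → b i (c j) = 0 := fun i j hj => by rw [hK _ hj, map_zero]
  refine ⟨N + K, fun n hn => Finset.sum_eq_zero fun p hp => ?_, fun t => ?_⟩
  · rw [Finset.HasAntidiagonal.mem_antidiagonal] at hp
    rcases le_or_gt K p.2 with h | h
    · exact hzero' _ _ h
    · exact hzero _ _ (by omega)
  · rw [← sum_pow_smul_sum_pow_smul (fun i j => b i (c j)) N K hzero hzero']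
    simp only [hfK, map_sum]
    refine Finset.sum_congr rfl fun j hj => ?_
    rw [map_smul, (hN' j N (hle j (Finset.mem_range.1 hj))).2 t]

end HasCoeffs

end HasCoeffs

/-! ### The star-product on `S(𝔤)` and its terms of order zero and one. -/

section Star

variable {𝔤 : Type*} [LieRing 𝔤] [LieAlgebra ℂ 𝔤] {κ : Type*} (X : Module.Basis κ ℂ 𝔤) [Fintype κ]

theorem hasCoeffs_evalSeries {M : Type*} [AddCommGroup M] [Module ℂ M] (F : locallyFiniteSeries M)
    (b : M) : HasCoeffs (fun t => evalSeries t F b)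
      (fun k => PowerSeries.coeff k (F : (Module.End ℂ M)⟦X⟧) b) := by
  obtain ⟨N, hN⟩ := F.2 b
  exact ⟨N, hN, fun t => evalSeries_apply t F b hN⟩

theorem poisson_mul_left (a c b : SymmetricAlgebra ℂ 𝔤) :
    poisson X (a * c) b = a * poisson X c b + c * poisson X a b := by
  simp only [poisson, LinearMap.sum_apply, LinearMap.compr₂_apply, LinearMap.compl₁₂_apply,
    LinearMap.mul_apply', LinearMap.mulLeft_apply, partialDeriv_mul, Finset.mul_sum,
    ← Finset.sum_add_distrib]
  exact Finset.sum_congr rfl fun i _ => Finset.sum_congr rfl fun j _ => by ring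

theorem poisson_mul_right (a b c : SymmetricAlgebra ℂ 𝔤) :
    poisson X a (b * c) = b * poisson X a c + c * poisson X a b := by
  simp only [poisson, LinearMap.sum_apply, LinearMap.compr₂_apply, LinearMap.compl₁₂_apply,
    LinearMap.mul_apply', LinearMap.mulLeft_apply, partialDeriv_mul, Finset.mul_sum,
    ← Finset.sum_add_distrib]
  exact Finset.sum_congr rfl fun i _ => Finset.sum_congr rfl fun j _ => by ring

theorem coeff_zero_gutt_pow (x : 𝔤) (n : ℕ) (b : SymmetricAlgebra ℂ 𝔤) :
    PowerSeries.coeff 0 (gutt X x ^ n) b = SymmetricAlgebra.ι ℂ 𝔤 x ^ n * b := by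
  induction n with
  | zero => simp
  | succ n ih =>
    rw [pow_succ', PowerSeries.coeff_mul, Finset.Nat.antidiagonal_zero, Finset.sum_singleton,
      Module.End.mul_apply, ih, coeff_gutt, bernoulliCoeff_zero, one_smul, adOp_zero,
      LinearMap.mulLeft_apply, pow_succ', mul_assoc]

/-- For one factor, `B_1 = -1/2` and `W_1(x) = -{x, ·}` give `{x, b} / 2`. The induction closes
because `{x, x^n} = 0`, so only the derivative of `b` contributes in `{x, x^n b}`. -/
theorem coeff_one_gutt_pow (x : 𝔤) (n : ℕ) (b : SymmetricAlgebra ℂ 𝔤) :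
    PowerSeries.coeff 1 (gutt X x ^ n) b =
      (1 / 2 : ℂ) • poisson X (SymmetricAlgebra.ι ℂ 𝔤 x ^ n) b := by
  induction n with
  | zero =>
    have h : poisson X (1 : SymmetricAlgebra ℂ 𝔤) b = 0 := by
      have := poisson_mul_left X 1 1 b
      simpa using this
    simp [PowerSeries.coeff_one, h]
  | succ n ih =>
    have h : poisson X (SymmetricAlgebra.ι ℂ 𝔤 x) (SymmetricAlgebra.ι ℂ 𝔤 x ^ n) = 0 := by
      have := adOp_succ_pow X 0 n x
      rwa [zero_add, adOp_one, neg_eq_zero] at this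
    rw [pow_succ', PowerSeries.coeff_mul, Finset.Nat.sum_antidiagonal_eq_sum_range_succ_mk,
      Finset.sum_range_succ, Finset.sum_range_one, LinearMap.add_apply]
    change PowerSeries.coeff 0 (gutt X x) (PowerSeries.coeff 1 (gutt X x ^ n) b) +
      PowerSeries.coeff 1 (gutt X x) (PowerSeries.coeff 0 (gutt X x ^ n) b) = _
    rw [ih, coeff_zero_gutt_pow, coeff_gutt, coeff_gutt, bernoulliCoeff_zero, bernoulliCoeff_one,
      one_smul, adOp_zero, LinearMap.smul_apply, adOp_one, poisson_mul_right, h, mul_zero, add_zero,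
      pow_succ', poisson_mul_left, LinearMap.mulLeft_apply, mul_smul_comm, smul_neg, neg_smul,
      neg_neg, smul_add]

variable [FiniteDimensional ℂ 𝔤]

theorem exists_hasCoeffs_guttRep (a b : SymmetricAlgebra ℂ 𝔤) :
    ∃ c, HasCoeffs (fun t => guttRep X t (pbw 𝔤 t a) b) c := by
  have h : a ∈ Submodule.span ℂ
      (Set.range fun p : 𝔤 × ℕ => SymmetricAlgebra.ι ℂ 𝔤 p.1 ^ p.2) := span_pow_ι 𝔤 ▸ trivial
  induction h using Submodule.span_induction with
  | mem a ha =>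
    obtain ⟨⟨x, n⟩, rfl⟩ := ha
    simp only [pbw_pow_ι, map_pow, guttRep_ι]
    simp only [← map_pow]
    exact ⟨_, hasCoeffs_evalSeries _ _⟩
  | zero => exact ⟨0, by simpa using HasCoeffs.zero⟩
  | add a a' _ _ ha ha' =>
    obtain ⟨c, hc⟩ := ha
    obtain ⟨c', hc'⟩ := ha'
    exact ⟨c + c', by simpa using hc.add hc'⟩
  | smul z a _ ha =>
    obtain ⟨c, hc⟩ := ha
    exact ⟨z • c, by simpa using hc.smul z⟩

/-- All coefficients of the star-product `a *_t b` on `S(𝔤)` together. -/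
def guttCoeffs : SymmetricAlgebra ℂ 𝔤 →ₗ[ℂ] SymmetricAlgebra ℂ 𝔤 →ₗ[ℂ] ℕ → SymmetricAlgebra ℂ 𝔤 :=
  LinearMap.mk₂ ℂ (fun a b => (exists_hasCoeffs_guttRep X a b).choose)
    (fun a a' b => by
      refine (exists_hasCoeffs_guttRep X (a + a') b).choose_spec.unique ?_
      simpa using (exists_hasCoeffs_guttRep X a b).choose_spec.add
        (exists_hasCoeffs_guttRep X a' b).choose_spec)
    (fun z a b => by
      refine (exists_hasCoeffs_guttRep X (z • a) b).choose_spec.unique ?_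
      simpa using (exists_hasCoeffs_guttRep X a b).choose_spec.smul z)
    (fun a b b' => by
      refine (exists_hasCoeffs_guttRep X a (b + b')).choose_spec.unique ?_
      simpa using (exists_hasCoeffs_guttRep X a b).choose_spec.add
        (exists_hasCoeffs_guttRep X a b').choose_spec)
    (fun z a b => by
      refine (exists_hasCoeffs_guttRep X a (z • b)).choose_spec.unique ?_
      simpa using (exists_hasCoeffs_guttRep X a b).choose_spec.smul z)

theorem hasCoeffs_guttCoeffs (a b : SymmetricAlgebra ℂ 𝔤) :
    HasCoeffs (fun t => guttRep X t (pbw 𝔤 t a) b) (guttCoeffs X a b) :=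
  (exists_hasCoeffs_guttRep X a b).choose_spec

theorem guttCoeffs_pow (x : 𝔤) (n : ℕ) (b : SymmetricAlgebra ℂ 𝔤) (k : ℕ) :
    guttCoeffs X (SymmetricAlgebra.ι ℂ 𝔤 x ^ n) b k = PowerSeries.coeff k (gutt X x ^ n) b := by
  have h := hasCoeffs_guttCoeffs X (SymmetricAlgebra.ι ℂ 𝔤 x ^ n) b
  simp only [pbw_pow_ι, map_pow, guttRep_ι] at h
  simp only [← map_pow] at h
  exact congrFun (h.unique (hasCoeffs_evalSeries _ _)) k

/-- The coefficient of `t^k` in the star-product on `S(𝔤)`. -/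
def guttCoeff (k : ℕ) :
    SymmetricAlgebra ℂ 𝔤 →ₗ[ℂ] SymmetricAlgebra ℂ 𝔤 →ₗ[ℂ] SymmetricAlgebra ℂ 𝔤 :=
  (guttCoeffs X).compr₂ (LinearMap.proj k)

theorem guttCoeff_pow (x : 𝔤) (n : ℕ) (b : SymmetricAlgebra ℂ 𝔤) (k : ℕ) :
    guttCoeff X k (SymmetricAlgebra.ι ℂ 𝔤 x ^ n) b = PowerSeries.coeff k (gutt X x ^ n) b :=
  guttCoeffs_pow X x n b k

theorem guttCoeff_eq_of_pow {k : ℕ}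
    {B : SymmetricAlgebra ℂ 𝔤 →ₗ[ℂ] SymmetricAlgebra ℂ 𝔤 →ₗ[ℂ] SymmetricAlgebra ℂ 𝔤}
    (h : ∀ (x : 𝔤) (n : ℕ) (b : SymmetricAlgebra ℂ 𝔤), PowerSeries.coeff k (gutt X x ^ n) b = B (SymmetricAlgebra.ι ℂ 𝔤 x ^ n) b) :
    guttCoeff X k = B := by
  refine LinearMap.ext_on_range (span_pow_ι 𝔤) fun p => LinearMap.ext fun b => ?_
  rw [guttCoeff_pow, h]

theorem guttCoeff_zero : guttCoeff X 0 = LinearMap.mul ℂ (SymmetricAlgebra ℂ 𝔤) :=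
  guttCoeff_eq_of_pow X fun x n b => coeff_zero_gutt_pow X x n b

theorem guttCoeff_one : guttCoeff X 1 = (1 / 2 : ℂ) • poisson X :=
  guttCoeff_eq_of_pow X fun x n b => coeff_one_gutt_pow X x n b

/-- Writing the product as `pbw c` and letting both sides act on `1` gives `c = guttRep (pbw a) b`;
this identifies the action with the star-product. -/
theorem pbw_guttRep (t : ℂ) (a b : SymmetricAlgebra ℂ 𝔤) :
    pbw 𝔤 t (guttRep X t (pbw 𝔤 t a) b) = pbw 𝔤 t a * pbw 𝔤 t b := by
  obtain ⟨c, hc⟩ := pbw_surjective t (pbw 𝔤 t a * pbw 𝔤 t b)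
  have h := guttRep_pbw_one X t c
  rw [hc, map_mul, Module.End.mul_apply, guttRep_pbw_one] at h
  rw [h, hc]

end Star

/-! ### The star-product on `End V ⊗ S(𝔤)`. -/

section MatrixStar

variable {𝔤 : Type*} [LieRing 𝔤] [LieAlgebra ℂ 𝔤] [FiniteDimensional ℂ 𝔤]
  {V : Type*} [AddCommGroup V] [Module ℂ V]

theorem familyPBW_bijective (t : ℂ) : Function.Bijective (familyPBW 𝔤 V t) :=
  (LinearEquiv.lTensor (Module.End ℂ V) (LinearEquiv.ofBijective _ (pbw_bijective (𝔤 := 𝔤) t))).bijective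

theorem familyPBW_starProduct (t : ℂ) (a b : ClassicalMatrix 𝔤 V) :
    familyPBW 𝔤 V t (starProduct t a b) = familyPBW 𝔤 V t a * familyPBW 𝔤 V t b :=
  Function.rightInverse_invFun (familyPBW_bijective t).surjective _

theorem starProduct_assoc (t : ℂ) (a b c : ClassicalMatrix 𝔤 V) :
    starProduct t (starProduct t a b) c = starProduct t a (starProduct t b c) :=
  (familyPBW_bijective t).injective (by simp only [familyPBW_starProduct, mul_assoc])

/-- The star-product as a bilinear map. -/
def starProductₗ (t : ℂ) :
    ClassicalMatrix 𝔤 V →ₗ[ℂ] ClassicalMatrix 𝔤 V →ₗ[ℂ] ClassicalMatrix 𝔤 V :=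
  LinearMap.mk₂ ℂ (starProduct t)
    (fun a a' b => (familyPBW_bijective t).injective (by
      simp only [familyPBW_starProduct, map_add, add_mul]))
    (fun c a b => (familyPBW_bijective t).injective (by
      simp only [familyPBW_starProduct, map_smul, smul_mul_assoc]))
    (fun a b b' => (familyPBW_bijective t).injective (by
      simp only [familyPBW_starProduct, map_add, mul_add]))
    (fun c a b => (familyPBW_bijective t).injective (by
      simp only [familyPBW_starProduct, map_smul, mul_smul_comm]))

theorem starProductₗ_apply (t : ℂ) (a b : ClassicalMatrix 𝔤 V) :
    starProductₗ t a b = starProduct t a b := rfl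

variable {κ : Type*} (X : Module.Basis κ ℂ 𝔤) [Fintype κ]

theorem starProduct_tmul (t : ℂ) (A B : Module.End ℂ V) (a b : SymmetricAlgebra ℂ 𝔤) :
    starProduct t (A ⊗ₜ[ℂ] a) (B ⊗ₜ[ℂ] b) = (A * B) ⊗ₜ[ℂ] guttRep X t (pbw 𝔤 t a) b := by
  apply (familyPBW_bijective t).injective
  rw [familyPBW_starProduct]
  simp only [familyPBW, LinearMap.lTensor_tmul, Algebra.TensorProduct.tmul_mul_tmul, pbw_guttRep]

variable (V) in
/-- The coefficient of `t^k` in the star-product on `End V ⊗ S(𝔤)`. -/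
def starCoeff (k : ℕ) :
    ClassicalMatrix 𝔤 V →ₗ[ℂ] ClassicalMatrix 𝔤 V →ₗ[ℂ] ClassicalMatrix 𝔤 V :=
  TensorProduct.map₂ (LinearMap.mul ℂ (Module.End ℂ V)) (guttCoeff X k)

theorem starCoeff_tmul (k : ℕ) (A B : Module.End ℂ V) (a b : SymmetricAlgebra ℂ 𝔤) :
    starCoeff V X k (A ⊗ₜ[ℂ] a) (B ⊗ₜ[ℂ] b) = (A * B) ⊗ₜ[ℂ] guttCoeff X k a b := by
  simp [starCoeff]

theorem starCoeff_zero : starCoeff V X 0 = LinearMap.mul ℂ (ClassicalMatrix 𝔤 V) := by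
  ext A a B b
  simp [starCoeff_tmul, guttCoeff_zero]

theorem starCoeff_one : starCoeff V X 1 = (1 / 2 : ℂ) • familyPoisson V X := by
  refine TensorProduct.ext' fun A a => TensorProduct.ext' fun B b => ?_
  rw [starCoeff_tmul, guttCoeff_one, LinearMap.smul_apply, LinearMap.smul_apply, LinearMap.smul_apply,
    LinearMap.smul_apply, familyPoisson_tmul, TensorProduct.tmul_smul]

theorem hasCoeffs_starProduct (a b : ClassicalMatrix 𝔤 V) :
    HasCoeffs (fun t => starProduct t a b) (fun k => starCoeff V X k a b) := by
  simp only [← starProductₗ_apply]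
  induction a using TensorProduct.induction_on with
  | zero => simp only [map_zero, LinearMap.zero_apply]; exact HasCoeffs.zero
  | add a a' ha ha' => simp only [map_add, LinearMap.add_apply]; exact ha.add ha'
  | tmul A a =>
  induction b using TensorProduct.induction_on with
  | zero => simp only [map_zero]; exact HasCoeffs.zero
  | add b b' hb hb' => simp only [map_add]; exact hb.add hb'
  | tmul B b =>
    simp only [starProductₗ_apply, starProduct_tmul X, starCoeff_tmul]
    exact (hasCoeffs_guttCoeffs X a b).map (TensorProduct.mk ℂ _ _ (A * B))

/-- Both sums are the coefficients of the same polynomial in `t`, since each product `*_t` is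
associative. -/
theorem starCoeff_assoc (n : ℕ) (a b c : ClassicalMatrix 𝔤 V) :
    ∑ p ∈ Finset.HasAntidiagonal.antidiagonal n, starCoeff V X p.1 (starCoeff V X p.2 a b) c =
      ∑ p ∈ Finset.HasAntidiagonal.antidiagonal n, starCoeff V X p.1 a (starCoeff V X p.2 b c) := by
  have h1 := HasCoeffs.comp (B := fun t => (starProductₗ t).flip c)
    (b := fun k => (starCoeff V X k).flip c) (fun x => hasCoeffs_starProduct X x c)
    (hasCoeffs_starProduct X a b)
  have h2 := HasCoeffs.comp (B := fun t => starProductₗ t a)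
    (b := fun k => starCoeff V X k a) (fun x => hasCoeffs_starProduct X a x)
    (hasCoeffs_starProduct X b c)
  simp only [LinearMap.flip_apply, starProductₗ_apply, starProduct_assoc] at h1 h2
  exact congrFun (h1.unique h2) n

end MatrixStar

/-! ### Associativity over formal power series from associativity order by order. -/

section FormalAssociativity

variable {A : Type*} [Ring A] [Algebra ℂ A]

theorem extendedMul_assoc (m : ℕ → A →ₗ[ℂ] A →ₗ[ℂ] A)
    (hm : ∀ n a b c, ∑ p ∈ Finset.HasAntidiagonal.antidiagonal n, m p.1 (m p.2 a b) c =
      ∑ p ∈ Finset.HasAntidiagonal.antidiagonal n, m p.1 a (m p.2 b c)) (f g h : A⟦X⟧) :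
    extendedMul m (extendedMul m f g) h = extendedMul m f (extendedMul m g h) := by
  ext n
  -- The summation is regrouped with `s = (total order of the two products, total degree)`. Then `r`
  -- and `x` distribute the degrees among `f`, `g`, `h`, while `p` holds the orders of the outer and
  -- inner product. The other bracketing takes the same form, and the hypothesis applies to the sum
  -- over `p`.
  have h1 : PowerSeries.coeff n (extendedMul m (extendedMul m f g) h) =
      ∑ s ∈ Finset.HasAntidiagonal.antidiagonal n, ∑ r ∈ Finset.HasAntidiagonal.antidiagonal s.2,
        ∑ x ∈ Finset.HasAntidiagonal.antidiagonal r.2, ∑ p ∈ Finset.HasAntidiagonal.antidiagonal s.1,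
          m p.1 (m p.2 (PowerSeries.coeff r.1 f) (PowerSeries.coeff x.1 g))
            (PowerSeries.coeff x.2 h) := by
    simp only [extendedMul, PowerSeries.coeff_mk, map_sum, LinearMap.sum_apply]
    simp only [Finset.sum_sigma']
    refine Finset.sum_nbij'
      (fun w => ⟨(w.1.1 + w.2.2.1.1, w.2.2.2.1 + w.2.2.2.2 + w.2.1.2),
        ⟨(w.2.2.2.1, w.2.2.2.2 + w.2.1.2), ⟨(w.2.2.2.2, w.2.1.2), (w.1.1, w.2.2.1.1)⟩⟩⟩)
      (fun w => ⟨(w.2.2.2.1, w.2.2.2.2 + w.2.1.1 + w.2.2.1.1 + w.2.2.1.2),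
        ⟨(w.2.2.2.2 + w.2.1.1 + w.2.2.1.1, w.2.2.1.2),
          ⟨(w.2.2.2.2, w.2.1.1 + w.2.2.1.1), (w.2.1.1, w.2.2.1.1)⟩⟩⟩) ?_ ?_ ?_ ?_ ?_
    all_goals first
      | (rintro ⟨⟨p, q⟩, ⟨u, v⟩, ⟨i, j⟩, ⟨x, y⟩⟩ hw
         simp only [Finset.mem_sigma, Finset.HasAntidiagonal.mem_antidiagonal] at hw ⊢
         omega)
      | (rintro ⟨⟨p, q⟩, ⟨u, v⟩, ⟨i, j⟩, ⟨x, y⟩⟩ hw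
         simp only [Finset.mem_sigma, Finset.HasAntidiagonal.mem_antidiagonal] at hw ⊢
         obtain ⟨rfl, rfl, rfl, rfl⟩ := hw
         simp [add_assoc, add_left_comm])
      | exact fun _ _ => rfl
  have h2 : PowerSeries.coeff n (extendedMul m f (extendedMul m g h)) =
      ∑ s ∈ Finset.HasAntidiagonal.antidiagonal n, ∑ r ∈ Finset.HasAntidiagonal.antidiagonal s.2,
        ∑ x ∈ Finset.HasAntidiagonal.antidiagonal r.2, ∑ p ∈ Finset.HasAntidiagonal.antidiagonal s.1,
          m p.1 (PowerSeries.coeff r.1 f) (m p.2 (PowerSeries.coeff x.1 g)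
            (PowerSeries.coeff x.2 h)) := by
    simp only [extendedMul, PowerSeries.coeff_mk, map_sum]
    simp only [Finset.sum_sigma']
    refine Finset.sum_nbij'
      (fun w => ⟨(w.1.1 + w.2.2.1.1, w.2.1.1 + w.2.2.2.1 + w.2.2.2.2),
        ⟨(w.2.1.1, w.2.2.2.1 + w.2.2.2.2), ⟨w.2.2.2, (w.1.1, w.2.2.1.1)⟩⟩⟩)
      (fun w => ⟨(w.2.2.2.1, w.2.1.1 + (w.2.2.2.2 + w.2.2.1.1 + w.2.2.1.2)),
        ⟨(w.2.1.1, w.2.2.2.2 + w.2.2.1.1 + w.2.2.1.2),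
          ⟨(w.2.2.2.2, w.2.2.1.1 + w.2.2.1.2), w.2.2.1⟩⟩⟩) ?_ ?_ ?_ ?_ ?_
    all_goals first
      | (rintro ⟨⟨p, q⟩, ⟨u, v⟩, ⟨i, j⟩, ⟨x, y⟩⟩ hw
         simp only [Finset.mem_sigma, Finset.HasAntidiagonal.mem_antidiagonal] at hw ⊢
         omega)
      | (rintro ⟨⟨p, q⟩, ⟨u, v⟩, ⟨i, j⟩, ⟨x, y⟩⟩ hw
         simp only [Finset.mem_sigma, Finset.HasAntidiagonal.mem_antidiagonal] at hw ⊢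
         obtain ⟨rfl, rfl, rfl, rfl⟩ := hw
         simp [add_assoc, add_left_comm])
      | exact fun _ _ => rfl
  rw [h1, h2]
  exact Finset.sum_congr rfl fun s _ => Finset.sum_congr rfl fun r _ =>
    Finset.sum_congr rfl fun x _ => hm _ _ _ _

end FormalAssociativity

/-! ### Equivariance of `F_t` and the deformation of the invariants. -/

section Equivariance

variable {𝔤 : Type*} [LieRing 𝔤] [LieAlgebra ℂ 𝔤] [FiniteDimensional ℂ 𝔤]

/-- Symmetrization sends `x ^ n` to `ι x ^ n`, so both sides agree on powers, which span. -/
theorem map_pbw (t : ℂ) (φ : 𝔤 ≃ₗ⁅ℂ⁆ 𝔤) (a : SymmetricAlgebra ℂ 𝔤) :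
    DeformedU.map t φ (pbw 𝔤 t a) =
      pbw 𝔤 t (SymmetricAlgebra.lift (SymmetricAlgebra.ι ℂ 𝔤 ∘ₗ (φ : 𝔤 →ₗ[ℂ] 𝔤)) a) := by
  have h : (DeformedU.map t φ).toLinearMap ∘ₗ pbw 𝔤 t = pbw 𝔤 t ∘ₗ
      (SymmetricAlgebra.lift (SymmetricAlgebra.ι ℂ 𝔤 ∘ₗ (φ : 𝔤 →ₗ[ℂ] 𝔤))).toLinearMap := by
    refine LinearMap.ext_on_range (span_pow_ι 𝔤) fun p => ?_
    have hι : DeformedU.map t φ (DeformedU.ι t p.1) = DeformedU.ι t (φ p.1) :=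
      DeformedU.lift_ι _ _ _ _
    simp only [LinearMap.comp_apply, AlgHom.toLinearMap_apply, pbw_pow_ι, map_pow, hι,
      SymmetricAlgebra.lift_ι_apply]
    rfl
  exact congrArg (fun f => f a) h

variable {V : Type*} [AddCommGroup V] [Module ℂ V] [FiniteDimensional ℂ V]
  [LieRingModule 𝔤 V] [LieModule ℂ 𝔤 V]

theorem quantumAction_familyPBW (t : ℂ) (g : List 𝔤) (a : ClassicalMatrix 𝔤 V) :
    quantumAction V t g (familyPBW 𝔤 V t a) = familyPBW 𝔤 V t (classicalAction V g a) := by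
  induction a using TensorProduct.induction_on with
  | zero => simp
  | add a b ha hb => simp only [map_add, ha, hb]
  | tmul A a =>
    simp only [quantumAction, classicalAction, familyPBW, LinearMap.lTensor_tmul,
      Algebra.TensorProduct.map_tmul, map_pbw]

theorem familyPBW_mem_iff (t : ℂ) (a : ClassicalMatrix 𝔤 V) :
    familyPBW 𝔤 V t a ∈ quantumFamilyAlgebra 𝔤 V t ↔ a ∈ classicalFamilyAlgebra 𝔤 V := by
  simp only [mem_quantumFamilyAlgebra, mem_classicalFamilyAlgebra, quantumAction_familyPBW,
    (familyPBW_bijective t).injective.eq_iff]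

theorem familyPBW_bijOn (t : ℂ) : Set.BijOn (familyPBW 𝔤 V t)
    (classicalFamilyAlgebra 𝔤 V : Set (ClassicalMatrix 𝔤 V))
    (quantumFamilyAlgebra 𝔤 V t : Set (QuantumMatrix 𝔤 V t)) := by
  refine ⟨fun a ha => (familyPBW_mem_iff t a).2 ha, (familyPBW_bijective t).injective.injOn,
    fun u hu => ?_⟩
  obtain ⟨a, rfl⟩ := (familyPBW_bijective t).surjective u
  exact ⟨a, (familyPBW_mem_iff t a).1 hu, rfl⟩

theorem starProduct_mem (t : ℂ) {a b : ClassicalMatrix 𝔤 V} (ha : a ∈ classicalFamilyAlgebra 𝔤 V)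
    (hb : b ∈ classicalFamilyAlgebra 𝔤 V) : starProduct t a b ∈ classicalFamilyAlgebra 𝔤 V := by
  rw [← familyPBW_mem_iff t, familyPBW_starProduct]
  exact mul_mem ((familyPBW_mem_iff t a).2 ha) ((familyPBW_mem_iff t b).2 hb)

variable {κ : Type*} (X : Module.Basis κ ℂ 𝔤) [Fintype κ]

/-- All values of the polynomial `a *_t b` are invariant, hence so are its coefficients. -/
theorem starCoeff_mem (k : ℕ) {a b : ClassicalMatrix 𝔤 V} (ha : a ∈ classicalFamilyAlgebra 𝔤 V)
    (hb : b ∈ classicalFamilyAlgebra 𝔤 V) : starCoeff V X k a b ∈ classicalFamilyAlgebra 𝔤 V :=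
  (hasCoeffs_starProduct X a b).mem (Subalgebra.toSubmodule (classicalFamilyAlgebra 𝔤 V))
    (fun t => starProduct_mem t ha hb) k

variable (V) in
/-- The coefficient of `t^k` in the star-product on the classical family algebra. -/
def familyCoeff (k : ℕ) : classicalFamilyAlgebra 𝔤 V →ₗ[ℂ] classicalFamilyAlgebra 𝔤 V →ₗ[ℂ]
    classicalFamilyAlgebra 𝔤 V :=
  LinearMap.mk₂ ℂ (fun a b => ⟨starCoeff V X k a b, starCoeff_mem X k a.2 b.2⟩)
    (fun a a' b => Subtype.ext (by simp))
    (fun c a b => Subtype.ext (by simp))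
    (fun a b b' => Subtype.ext (by simp))
    (fun c a b => Subtype.ext (by simp))

theorem coe_familyCoeff (k : ℕ) (a b : classicalFamilyAlgebra 𝔤 V) :
    (familyCoeff V X k a b : ClassicalMatrix 𝔤 V) = starCoeff V X k a b := rfl

variable (V) in
/-- The deformation of the classical family algebra given by the star-products. -/
def starDeformation : FormalDeformation (classicalFamilyAlgebra 𝔤 V) where
  coeff := familyCoeff V X
  coeff_zero := by
    refine LinearMap.ext fun a => LinearMap.ext fun b => Subtype.ext ?_
    rw [coe_familyCoeff, starCoeff_zero]
    rfl
  assoc := extendedMul_assoc _ fun n a b c => Subtype.ext (by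
    simpa only [AddSubmonoidClass.coe_finsetSum, coe_familyCoeff] using
      starCoeff_assoc X n (a : ClassicalMatrix 𝔤 V) b c)

theorem isStarDeformation_iff (m : FormalDeformation (classicalFamilyAlgebra 𝔤 V)) :
    IsStarDeformation m ↔ ∀ a b : classicalFamilyAlgebra 𝔤 V,
      HasCoeffs (fun t => starProduct t (a : ClassicalMatrix 𝔤 V) (b : ClassicalMatrix 𝔤 V))
        (fun k => (m.coeff k a b : ClassicalMatrix 𝔤 V)) := by
  simp only [IsStarDeformation, HasCoeffs, ZeroMemClass.coe_eq_zero]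

theorem isStarDeformation_starDeformation : IsStarDeformation (starDeformation V X) :=
  (isStarDeformation_iff _).2 fun a b => hasCoeffs_starProduct X (a : ClassicalMatrix 𝔤 V) b

theorem IsStarDeformation.eq_starDeformation {m : FormalDeformation (classicalFamilyAlgebra 𝔤 V)}
    (hm : IsStarDeformation m) : m = starDeformation V X := by
  refine FormalDeformation.ext (funext fun k => LinearMap.ext fun a => LinearMap.ext fun b =>
    Subtype.ext ?_)
  exact congrFun (((isStarDeformation_iff m).1 hm a b).unique
    (hasCoeffs_starProduct X (a : ClassicalMatrix 𝔤 V) b)) k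

end Equivariance

/-! ### Derivatives of curves in finite-dimensional pieces of spaces without a topology. -/

section WeakDerivative

variable {E F G : Type*} [AddCommGroup E] [Module ℂ E] [AddCommGroup F] [Module ℂ F]
  [AddCommGroup G] [Module ℂ G]

/-- `f` is a finite combination `∑ g_i(s) e_i` of vectors with coefficients differentiable at `0`,
and its derivative at `0` is `f'`. -/
inductive HasFiniteDeriv : (ℂ → E) → E → Prop
  | smul (g : ℂ → ℂ) (g' : ℂ) (e : E) : HasDerivAt g g' 0 →
      HasFiniteDeriv (fun s => g s • e) (g' • e)
  | add (f₁ f₂ : ℂ → E) (f₁' f₂' : E) : HasFiniteDeriv f₁ f₁' → HasFiniteDeriv f₂ f₂' →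
      HasFiniteDeriv (fun s => f₁ s + f₂ s) (f₁' + f₂')

namespace HasFiniteDeriv

theorem hasDerivAt {f : ℂ → E} {f' : E} (h : HasFiniteDeriv f f') (φ : Module.Dual ℂ E) :
    HasDerivAt (fun s => φ (f s)) (φ f') 0 := by
  induction h with
  | smul g g' e hg => simpa using hg.mul_const (φ e)
  | add f₁ f₂ f₁' f₂' _ _ h₁ h₂ => simp only [map_add]; exact h₁.add h₂

theorem eq_zero_of_const {e f' : E} (h : HasFiniteDeriv (fun _ => e) f') : f' = 0 := by
  rw [← Module.forall_dual_apply_eq_zero_iff ℂ]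
  exact fun φ => (h.hasDerivAt φ).unique (hasDerivAt_const _ _)

theorem const (e : E) : HasFiniteDeriv (fun _ => e) (0 : E) := by
  simpa using HasFiniteDeriv.smul (fun _ => 1) 0 e (hasDerivAt_const _ _)

theorem sum {ι : Type*} (s : Finset ι) {f : ι → ℂ → E} {f' : ι → E}
    (h : ∀ i, HasFiniteDeriv (f i) (f' i)) :
    HasFiniteDeriv (fun z => ∑ i ∈ s, f i z) (∑ i ∈ s, f' i) := by
  classical
  induction s using Finset.induction_on with
  | empty => simpa using const (0 : E)
  | insert i s hi ih => simpa only [Finset.sum_insert hi] using (h i).add _ _ _ _ ih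

theorem bilin (B : E →ₗ[ℂ] F →ₗ[ℂ] G) {f : ℂ → E} {f' : E} {g : ℂ → F} {g' : F}
    (hf : HasFiniteDeriv f f') (hg : HasFiniteDeriv g g') :
    HasFiniteDeriv (fun s => B (f s) (g s)) (B f' (g 0) + B (f 0) g') := by
  induction hf with
  | add f₁ f₂ f₁' f₂' _ _ h₁ h₂ =>
    have := h₁.add _ _ _ _ h₂
    convert this using 1
    · simp
    · simp only [map_add, LinearMap.add_apply]; abel
  | smul p p' e hp =>
  induction hg with
  | add f₁ f₂ f₁' f₂' _ _ h₁ h₂ =>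
    have := h₁.add _ _ _ _ h₂
    convert this using 1
    · simp
    · simp only [map_add]; abel
  | smul q q' e' hq =>
    have := HasFiniteDeriv.smul _ _ (B e e') (hp.mul hq)
    convert this using 1
    · simp [smul_smul, mul_comm]
    · simp [smul_smul, add_smul, mul_comm]

theorem map (L : E →ₗ[ℂ] F) {f : ℂ → E} {f' : E} (hf : HasFiniteDeriv f f') :
    HasFiniteDeriv (fun s => L (f s)) (L f') := by
  induction hf with
  | smul g g' e hg => simp only [map_smul]; exact .smul g g' (L e) hg
  | add f₁ f₂ f₁' f₂' _ _ h₁ h₂ => simp only [map_add]; exact h₁.add _ _ _ _ h₂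

end HasFiniteDeriv

theorem hasFiniteDeriv_linExp {W : Type*} [AddCommGroup W] [Module ℂ W] [FiniteDimensional ℂ W]
    (f : Module.End ℂ W) : HasFiniteDeriv (fun s : ℂ => linExp (s • f)) f := by
  set e := LinearMap.toMatrixAlgEquiv (Module.finBasis ℂ W) with he
  have hd : ∀ T : Module.Dual ℂ (Module.End ℂ W),
      HasDerivAt (fun s : ℂ => T (linExp (s • f))) (T f) 0 := by
    intro T
    let _ : NormedRing (Matrix (Fin (Module.finrank ℂ W)) (Fin (Module.finrank ℂ W)) ℂ) :=
      Matrix.linftyOpNormedRing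
    let _ : NormedAlgebra ℂ (Matrix (Fin (Module.finrank ℂ W)) (Fin (Module.finrank ℂ W)) ℂ) :=
      Matrix.linftyOpNormedAlgebra
    have h := hasDerivAt_exp_smul_const (𝕂 := ℂ) (e f) (0 : ℂ)
    let T' : Matrix (Fin (Module.finrank ℂ W)) (Fin (Module.finrank ℂ W)) ℂ →L[ℂ] ℂ :=
      LinearMap.toContinuousLinearMap (T ∘ₗ e.symm.toLinearMap)
    have h' := T'.hasFDerivAt.comp_hasDerivAt (0 : ℂ) h
    have hval : T' (NormedSpace.exp ((0 : ℂ) • e f) * e f) = T f := by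
      simp [T', NormedSpace.exp_zero]
    refine (h'.congr_deriv hval).congr_of_eventuallyEq (Filter.Eventually.of_forall fun s => ?_)
    have hs : linExp (s • f) = e.symm (NormedSpace.exp (s • e f)) := by rw [linExp, map_smul]
    exact congrArg T hs
  -- Expanding in a basis of `End W` exhibits the curve as a finite sum of scalar functions times
  -- fixed vectors.
  set b := Module.finBasis ℂ (Module.End ℂ W)
  have h := HasFiniteDeriv.sum Finset.univ fun i =>
    HasFiniteDeriv.smul _ _ (b i) (hd (b.coord i))
  simpa only [Module.Basis.coord_apply, b.sum_repr] using h

end WeakDerivative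

/-! ### Exponentials of intertwined operators and conjugation. -/

section LinExp

variable {W W' : Type*} [AddCommGroup W] [Module ℂ W] [FiniteDimensional ℂ W]
  [AddCommGroup W'] [Module ℂ W'] [FiniteDimensional ℂ W']

theorem linExp_intertwine {f : Module.End ℂ W} {f' : Module.End ℂ W'} (T : W →ₗ[ℂ] W')
    (h : T ∘ₗ f = f' ∘ₗ T) (w : W) : T (linExp f w) = linExp f' (T w) := by
  have hpow : ∀ n : ℕ, T ((f ^ n) w) = (f' ^ n) (T w) := by
    intro n
    induction n with
    | zero => simp
    | succ n ih =>
      rw [pow_succ', pow_succ', Module.End.mul_apply, Module.End.mul_apply, ← ih]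
      exact congrArg (fun g => g ((f ^ n) w)) h
  rw [← sub_eq_zero, ← Module.forall_dual_apply_eq_zero_iff ℂ]
  intro φ
  rw [map_sub, sub_eq_zero]
  have h1 := linExp_hasSum f w (φ ∘ₗ T)
  have h2 := linExp_hasSum f' (T w) φ
  simp only [LinearMap.comp_apply, hpow] at h1
  exact h1.unique h2

theorem linExp_mulLeft (f T : Module.End ℂ W) :
    linExp (LinearMap.mulLeft ℂ f) T = linExp f * T := by
  refine LinearMap.ext fun v => ?_
  have h0 : (LinearMap.applyₗ v : Module.End ℂ W →ₗ[ℂ] W) ∘ₗ LinearMap.mulLeft ℂ f =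
      f ∘ₗ (LinearMap.applyₗ v : Module.End ℂ W →ₗ[ℂ] W) := LinearMap.ext fun B => rfl
  have h := linExp_intertwine (LinearMap.applyₗ v : Module.End ℂ W →ₗ[ℂ] W) h0 T
  simpa only [LinearMap.applyₗ_apply_apply, Module.End.mul_apply] using h

theorem linExp_mulRight (f T : Module.End ℂ W) :
    linExp (LinearMap.mulRight ℂ f) T = T * linExp f := by
  -- At the identity, left and right multiplication by `f` have the same powers. Other `T` follow
  -- because left multiplication by `T` commutes with right multiplication by `f`.
  have h1 : linExp (LinearMap.mulRight ℂ f) 1 = linExp f := by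
    rw [← mul_one (linExp f), ← linExp_mulLeft, ← sub_eq_zero,
      ← Module.forall_dual_apply_eq_zero_iff ℂ]
    intro φ
    rw [map_sub, sub_eq_zero]
    have h1 := linExp_hasSum (LinearMap.mulRight ℂ f) 1 φ
    have h2 := linExp_hasSum (LinearMap.mulLeft ℂ f) 1 φ
    simp only [LinearMap.pow_mulLeft, LinearMap.pow_mulRight, LinearMap.mulLeft_apply,
      LinearMap.mulRight_apply, mul_one, one_mul] at h1 h2
    exact h1.unique h2
  have h := linExp_intertwine (LinearMap.mulLeft ℂ T) (f := LinearMap.mulRight ℂ f)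
    (f' := LinearMap.mulRight ℂ f) (by ext; simp [mul_assoc]) 1
  rw [h1] at h
  simpa using h.symm

theorem linExp_conj (f T : Module.End ℂ W) :
    linExp (LinearMap.mulLeft ℂ f - LinearMap.mulRight ℂ f) T = linExp f * T * linExp (-f) := by
  have hR : -LinearMap.mulRight ℂ f = LinearMap.mulRight ℂ (-f) := by ext; simp
  rw [sub_eq_add_neg, hR, linExp_add, Module.End.mul_apply, linExp_mulRight, linExp_mulLeft, mul_assoc]
  refine LinearMap.ext fun A => ?_
  simp [mul_assoc]

end LinExp

/-! ### The Poisson bracket through Hamiltonian derivations, and the operator `∑ τ(X_j) ⊗ ∂^j`. -/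

section PoissonBracket

variable {𝔤 : Type*} [LieRing 𝔤] [LieAlgebra ℂ 𝔤] {V : Type*} [AddCommGroup V] [Module ℂ V]
  {κ : Type*} (X : Module.Basis κ ℂ 𝔤)

theorem lTensor_partialDeriv_mul (j : κ) (a b : ClassicalMatrix 𝔤 V) :
    LinearMap.lTensor (Module.End ℂ V) (partialDeriv X j) (a * b) =
      LinearMap.lTensor (Module.End ℂ V) (partialDeriv X j) a * b +
        a * LinearMap.lTensor (Module.End ℂ V) (partialDeriv X j) b := by
  induction a using TensorProduct.induction_on with
  | zero => simp
  | add a a' ha ha' => simp only [map_add, ha, ha', add_mul]; abel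
  | tmul A a =>
  induction b using TensorProduct.induction_on with
  | zero => simp
  | add b b' hb hb' => simp only [map_add, hb, hb', mul_add]; abel
  | tmul B b =>
    simp only [Algebra.TensorProduct.tmul_mul_tmul, LinearMap.lTensor_tmul, partialDeriv_mul,
      TensorProduct.tmul_add]

variable [Fintype κ]

/-- The chain rule for the linear substitution `φ`. -/
theorem partialDeriv_lift (φ : 𝔤 →ₗ[ℂ] 𝔤) (j : κ)
    (a : SymmetricAlgebra ℂ 𝔤) :
    partialDeriv X j (SymmetricAlgebra.lift (SymmetricAlgebra.ι ℂ 𝔤 ∘ₗ φ) a) =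
      ∑ k, X.coord j (φ (X k)) •
        SymmetricAlgebra.lift (SymmetricAlgebra.ι ℂ 𝔤 ∘ₗ φ) (partialDeriv X k a) := by
  induction a using SymmetricAlgebra.induction with
  | algebraMap r => simp [partialDeriv_algebraMap]
  | ι x =>
    simp only [SymmetricAlgebra.lift_ι_apply, LinearMap.comp_apply, partialDeriv_ι, AlgHom.commutes]
    conv_lhs => rw [← X.sum_repr x]
    simp only [map_sum, map_smul, Algebra.smul_def, Module.Basis.coord_apply, map_mul]
    exact Finset.sum_congr rfl fun k _ => by simp [mul_comm]
  | mul a b ha hb =>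
    simp only [map_mul, partialDeriv_mul, ha, hb, map_add, smul_add, Finset.sum_add_distrib,
      Finset.sum_mul, Finset.mul_sum, smul_mul_assoc, mul_smul_comm]
  | add a b ha hb => simp only [map_add, ha, hb, smul_add, Finset.sum_add_distrib]

theorem poisson_ι_ι (x z : 𝔤) : poisson X (SymmetricAlgebra.ι ℂ 𝔤 x) (SymmetricAlgebra.ι ℂ 𝔤 z) =
    SymmetricAlgebra.ι ℂ 𝔤 ⁅x, z⁆ := by
  have h := adOp_one X x (SymmetricAlgebra.ι ℂ 𝔤 z)
  rw [← neg_eq_iff_eq_neg] at h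
  rw [← h, ← lie_skew, map_neg, neg_inj, adOp_succ]
  simp only [adOp_zero, partialDeriv_ι, LinearMap.mulLeft_apply, ← Algebra.commutes,
    ← Algebra.smul_def, ← map_smul, ← smul_lie, ← map_sum, ← sum_lie]
  congr 2
  exact (X.sum_repr z)

theorem poisson_algebraMap (a : SymmetricAlgebra ℂ 𝔤) (r : ℂ) :
    poisson X a (algebraMap ℂ _ r) = 0 := by
  simp [poisson, LinearMap.sum_apply, partialDeriv_algebraMap]

/-- Only the derivations `{X_j, ·}` are applied to `a`, and on invariants these can be traded for
commutators with `τ(X_j)`. -/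
theorem poisson_eq_sum (a b : SymmetricAlgebra ℂ 𝔤) : poisson X a b =
    -∑ j, poisson X (SymmetricAlgebra.ι ℂ 𝔤 (X j)) a * partialDeriv X j b := by
  have h : ∀ j, poisson X (SymmetricAlgebra.ι ℂ 𝔤 (X j)) a =
      -∑ i, SymmetricAlgebra.ι ℂ 𝔤 ⁅X i, X j⁆ * partialDeriv X i a := by
    intro j
    rw [← neg_eq_iff_eq_neg, ← adOp_one, adOp_succ]
    simp only [adOp_zero, LinearMap.mulLeft_apply]
  simp only [h, neg_mul, Finset.sum_neg_distrib, neg_neg, Finset.sum_mul]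
  rw [Finset.sum_comm]
  simp only [poisson, LinearMap.sum_apply, LinearMap.compr₂_apply, LinearMap.compl₁₂_apply,
    LinearMap.mul_apply', LinearMap.mulLeft_apply, mul_assoc]

theorem familyPoisson_eq_sum (a b : ClassicalMatrix 𝔤 V) : familyPoisson V X a b =
    -∑ j, LinearMap.lTensor (Module.End ℂ V) (poisson X (SymmetricAlgebra.ι ℂ 𝔤 (X j))) a *
      LinearMap.lTensor (Module.End ℂ V) (partialDeriv X j) b := by
  induction a using TensorProduct.induction_on with
  | zero => simp
  | add a a' ha ha' =>
    simp only [map_add, LinearMap.add_apply, ha, ha', add_mul, Finset.sum_add_distrib, neg_add]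
  | tmul A a =>
  induction b using TensorProduct.induction_on with
  | zero => simp
  | add b b' hb hb' => simp only [map_add, hb, hb', mul_add, Finset.sum_add_distrib, neg_add]
  | tmul B b =>
    rw [familyPoisson_tmul, poisson_eq_sum, TensorProduct.tmul_neg, TensorProduct.tmul_sum]
    simp only [LinearMap.lTensor_tmul, Algebra.TensorProduct.tmul_mul_tmul]

variable [LieRingModule 𝔤 V] [LieModule ℂ 𝔤 V]

variable (V) in
/-- The operator `∑ τ(X_j) ⊗ ∂^j` on `End V ⊗ S(𝔤)`. -/
def diracOp : ClassicalMatrix 𝔤 V →ₗ[ℂ] ClassicalMatrix 𝔤 V :=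
  ∑ j, TensorProduct.map (LinearMap.mulLeft ℂ (LieModule.toEnd ℂ 𝔤 V (X j))) (partialDeriv X j)

theorem diracOp_tmul (A : Module.End ℂ V) (a : SymmetricAlgebra ℂ 𝔤) :
    diracOp V X (A ⊗ₜ[ℂ] a) = ∑ j, (LieModule.toEnd ℂ 𝔤 V (X j) * A) ⊗ₜ[ℂ] partialDeriv X j a := by
  simp [diracOp, LinearMap.sum_apply]

theorem diracOp_eq_sum (a : ClassicalMatrix 𝔤 V) : diracOp V X a =
    ∑ j, (LieModule.toEnd ℂ 𝔤 V (X j) ⊗ₜ[ℂ] 1) *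
      LinearMap.lTensor (Module.End ℂ V) (partialDeriv X j) a := by
  induction a using TensorProduct.induction_on with
  | zero => simp
  | add a b ha hb => simp only [map_add, ha, hb, mul_add, Finset.sum_add_distrib]
  | tmul A a => simp [diracOp_tmul]

end PoissonBracket

/-! ### Infinitesimal conjugation on `End V`. -/

section Conjugation

variable {𝔤 : Type*} [LieRing 𝔤] [LieAlgebra ℂ 𝔤]
  {V : Type*} [AddCommGroup V] [Module ℂ V] [FiniteDimensional ℂ V]
  [LieRingModule 𝔤 V] [LieModule ℂ 𝔤 V]

theorem hasFiniteDeriv_conj (x : 𝔤) (A : Module.End ℂ V) :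
    HasFiniteDeriv (fun s : ℂ => (groupRep V [s • x]).conjAlgEquiv ℂ A)
      (LieModule.toEnd ℂ 𝔤 V x * A - A * LieModule.toEnd ℂ 𝔤 V x) := by
  have h := HasFiniteDeriv.bilin (LinearMap.mul ℂ (Module.End ℂ V))
    ((hasFiniteDeriv_linExp (LieModule.toEnd ℂ 𝔤 V x)).map (LinearMap.mulRight ℂ A))
    (hasFiniteDeriv_linExp (-LieModule.toEnd ℂ 𝔤 V x))
  simp only [LinearMap.mul_apply', LinearMap.mulRight_apply, zero_smul, linExp_zero, one_mul, mul_neg,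
    ← sub_eq_add_neg, smul_neg, neg_zero, mul_one] at h
  simp only [← map_smul] at h
  exact h

theorem conj_groupRep_zero (x : 𝔤) (A : Module.End ℂ V) :
    (groupRep V [(0 : ℂ) • x]).conjAlgEquiv ℂ A = A := by
  change linExp (LieModule.toEnd ℂ 𝔤 V ((0 : ℂ) • x)) * A *
    linExp (-LieModule.toEnd ℂ 𝔤 V ((0 : ℂ) • x)) = A
  simp [linExp_zero]

end Conjugation

/-! ### Infinitesimal invariance and the coboundary formula. -/

section GroupAction

variable {𝔤 : Type*} [LieRing 𝔤] [LieAlgebra ℂ 𝔤] [FiniteDimensional ℂ 𝔤]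
variable {V : Type*} [AddCommGroup V] [Module ℂ V] [FiniteDimensional ℂ V]
  [LieRingModule 𝔤 V] [LieModule ℂ 𝔤 V]

/-- The map `τ` intertwines `ad x` with the commutator by `τ(x)`, hence their exponentials, and the
exponential of a commutator is a conjugation. -/
theorem toEnd_expAd (x z : 𝔤) : LieModule.toEnd ℂ 𝔤 V (expAd x z) =
    linExp (LieModule.toEnd ℂ 𝔤 V x) * LieModule.toEnd ℂ 𝔤 V z * linExp (-LieModule.toEnd ℂ 𝔤 V x) := by
  rw [← linExp_conj]
  refine linExp_intertwine (LieModule.toEnd ℂ 𝔤 V : 𝔤 →ₗ[ℂ] Module.End ℂ V) ?_ z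
  ext z v
  simp

/-- `τ(g) τ(z) τ(g)⁻¹ = τ(Ad(g) z)`. -/
theorem groupRep_conj_toEnd (g : List 𝔤) (z : 𝔤) :
    (groupRep V g).conjAlgEquiv ℂ (LieModule.toEnd ℂ 𝔤 V z) =
      LieModule.toEnd ℂ 𝔤 V (groupAd g z) := by
  induction g with
  | nil => rfl
  | cons x l ih =>
    have h : LieModule.toEnd ℂ 𝔤 V (groupAd (x :: l) z) = linExp (LieModule.toEnd ℂ 𝔤 V x) *
        LieModule.toEnd ℂ 𝔤 V (groupAd l z) * linExp (-LieModule.toEnd ℂ 𝔤 V x) :=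
      toEnd_expAd x _
    rw [h, ← ih]
    rfl

variable {κ : Type*} [Fintype κ] (X : Module.Basis κ ℂ 𝔤)

/-- The operator is built from the canonical pairing of a basis with its dual: `τ(X_j)` transforms
by `Ad(g)` and `∂^j` contragrediently, so the two matrices cancel. -/
theorem classicalAction_diracOp (g : List 𝔤) (a : ClassicalMatrix 𝔤 V) :
    classicalAction V g (diracOp V X a) = diracOp V X (classicalAction V g a) := by
  induction a using TensorProduct.induction_on with
  | zero => simp
  | add a b ha hb => simp only [map_add, ha, hb]
  | tmul A a =>
    have hact : ∀ (B : Module.End ℂ V) (b : SymmetricAlgebra ℂ 𝔤), classicalAction V g (B ⊗ₜ[ℂ] b) =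
        ((groupRep V g).conjAlgEquiv ℂ B) ⊗ₜ[ℂ]
          SymmetricAlgebra.lift (SymmetricAlgebra.ι ℂ 𝔤 ∘ₗ (groupAd g : 𝔤 →ₗ[ℂ] 𝔤)) b :=
      fun B b => rfl
    rw [hact, diracOp_tmul, diracOp_tmul, map_sum]
    simp only [hact, map_mul, groupRep_conj_toEnd, partialDeriv_lift, TensorProduct.tmul_sum]
    rw [Finset.sum_comm]
    refine Finset.sum_congr rfl fun k _ => ?_
    simp only [TensorProduct.tmul_smul]
    simp only [TensorProduct.smul_tmul', ← smul_mul_assoc, ← map_smul, ← TensorProduct.sum_tmul,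
      ← Finset.sum_mul, ← map_sum]
    congr 3
    exact (X.sum_repr (groupAd g (X k))).symm

theorem diracOp_mem {a : ClassicalMatrix 𝔤 V} (ha : a ∈ classicalFamilyAlgebra 𝔤 V) :
    diracOp V X a ∈ classicalFamilyAlgebra 𝔤 V := by
  rw [mem_classicalFamilyAlgebra] at ha ⊢
  exact fun g => by rw [classicalAction_diracOp, ha]

theorem lift_groupAd_zero (x : 𝔤) (a : SymmetricAlgebra ℂ 𝔤) : SymmetricAlgebra.lift
    (SymmetricAlgebra.ι ℂ 𝔤 ∘ₗ (groupAd [(0 : ℂ) • x] : 𝔤 →ₗ[ℂ] 𝔤)) a = a := by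
  have h : (groupAd [(0 : ℂ) • x] : 𝔤 →ₗ[ℂ] 𝔤) = LinearMap.id := by
    refine LinearMap.ext fun z => ?_
    change linExp (LieAlgebra.ad ℂ 𝔤 ((0 : ℂ) • x)) z = z
    rw [zero_smul, map_zero, linExp_zero]
    rfl
  rw [h, LinearMap.comp_id, SymmetricAlgebra.lift_ι]
  rfl

/-- The derivative of the action of `exp(s x)` on `S(𝔤)` at `s = 0` is the Hamiltonian derivation. -/
theorem hasFiniteDeriv_lift_groupAd (x : 𝔤) (a : SymmetricAlgebra ℂ 𝔤) :
    HasFiniteDeriv (fun s : ℂ => SymmetricAlgebra.lift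
      (SymmetricAlgebra.ι ℂ 𝔤 ∘ₗ (groupAd [s • x] : 𝔤 →ₗ[ℂ] 𝔤)) a)
      (poisson X (SymmetricAlgebra.ι ℂ 𝔤 x) a) := by
  induction a using SymmetricAlgebra.induction with
  | algebraMap r =>
    simp only [AlgHom.commutes, poisson_algebraMap]
    exact HasFiniteDeriv.const _
  | ι z =>
    have h := (hasFiniteDeriv_linExp (LieAlgebra.ad ℂ 𝔤 x)).map
      (SymmetricAlgebra.ι ℂ 𝔤 ∘ₗ LinearMap.applyₗ z)
    simp only [SymmetricAlgebra.lift_ι_apply, poisson_ι_ι]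
    simp only [← map_smul] at h
    exact h
  | mul a b ha hb =>
    have h := HasFiniteDeriv.bilin (LinearMap.mul ℂ (SymmetricAlgebra ℂ 𝔤)) ha hb
    simp only [lift_groupAd_zero, LinearMap.mul_apply'] at h
    rw [poisson_mul_right, add_comm, mul_comm b]
    simpa only [map_mul] using h
  | add a b ha hb =>
    simp only [map_add]
    exact ha.add _ _ _ _ hb

/-- The elements of the classical family algebra are infinitesimally invariant. -/
theorem commutator_eq_poisson {a : ClassicalMatrix 𝔤 V} (ha : a ∈ classicalFamilyAlgebra 𝔤 V) (x : 𝔤) :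
    a * (LieModule.toEnd ℂ 𝔤 V x ⊗ₜ[ℂ] 1) - (LieModule.toEnd ℂ 𝔤 V x ⊗ₜ[ℂ] 1) * a =
      LinearMap.lTensor (Module.End ℂ V) (poisson X (SymmetricAlgebra.ι ℂ 𝔤 x)) a := by
  have h : ∀ a : ClassicalMatrix 𝔤 V, HasFiniteDeriv (fun s : ℂ => classicalAction V [s • x] a)
      ((LieModule.toEnd ℂ 𝔤 V x ⊗ₜ[ℂ] 1) * a - a * (LieModule.toEnd ℂ 𝔤 V x ⊗ₜ[ℂ] 1) +
        LinearMap.lTensor (Module.End ℂ V) (poisson X (SymmetricAlgebra.ι ℂ 𝔤 x)) a) := by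
    intro a
    induction a using TensorProduct.induction_on with
    | zero => simpa using HasFiniteDeriv.const (0 : ClassicalMatrix 𝔤 V)
    | add a b ha hb =>
      have := ha.add _ _ _ _ hb
      convert this using 1
      · simp only [map_add]
      · simp only [map_add, mul_add, add_mul]; abel
    | tmul A a =>
      have := HasFiniteDeriv.bilin (TensorProduct.mk ℂ (Module.End ℂ V) (SymmetricAlgebra ℂ 𝔤))
        (hasFiniteDeriv_conj x A) (hasFiniteDeriv_lift_groupAd X x a)
      simp only [TensorProduct.mk_apply, conj_groupRep_zero, lift_groupAd_zero] at this
      simp only [Algebra.TensorProduct.tmul_mul_tmul, one_mul, mul_one, LinearMap.lTensor_tmul,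
        ← TensorProduct.sub_tmul]
      exact this
  have h' := h a
  -- On an invariant element the curve `s ↦ exp(s x) · a` is constant, so its derivative vanishes.
  simp only [(mem_classicalFamilyAlgebra 𝔤 V).1 ha] at h'
  have h0 := h'.eq_zero_of_const
  rw [← sub_eq_zero, ← neg_eq_zero, ← h0]
  abel

/-- On the classical family algebra the Poisson bracket is a Hochschild coboundary. -/
theorem familyPoisson_eq_diracOp {a : ClassicalMatrix 𝔤 V} (ha : a ∈ classicalFamilyAlgebra 𝔤 V)
    (b : ClassicalMatrix 𝔤 V) : familyPoisson V X a b =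
      -(a * diracOp V X b - diracOp V X (a * b) + diracOp V X a * b) := by
  -- In the coboundary, the terms `τ(X_j) ∂^j a · b` cancel, leaving the commutators `a τ(X_j) -
  -- τ(X_j) a` times `∂^j b`.
  simp only [familyPoisson_eq_sum, ← commutator_eq_poisson X ha, diracOp_eq_sum,
    lTensor_partialDeriv_mul, Finset.mul_sum, Finset.sum_mul, ← Finset.sum_sub_distrib,
    ← Finset.sum_add_distrib]
  congr 1
  refine Finset.sum_congr rfl fun j _ => ?_
  simp only [sub_mul, mul_add, mul_assoc]
  abel

variable (V) in
/-- The Hochschild cochain `-1/2 ∑ τ(X_j) ∂^j` on the classical family algebra. -/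
def familyCochain : classicalFamilyAlgebra 𝔤 V →ₗ[ℂ] classicalFamilyAlgebra 𝔤 V where
  toFun a := ⟨(-(1 / 2) : ℂ) • diracOp V X a, Subalgebra.smul_mem _ (diracOp_mem X a.2) _⟩
  map_add' a b := Subtype.ext (by simp)
  map_smul' c a := Subtype.ext (by simp [smul_comm c])

theorem familyCoeff_one : familyCoeff V X 1 = hochschildD (familyCochain V X) := by
  refine LinearMap.ext fun a => LinearMap.ext fun b => Subtype.ext ?_
  rw [coe_familyCoeff, starCoeff_one, LinearMap.smul_apply, LinearMap.smul_apply,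
    familyPoisson_eq_diracOp X a.2]
  change _ = (a : ClassicalMatrix 𝔤 V) * ((-(1 / 2) : ℂ) • diracOp V X b) -
    (-(1 / 2) : ℂ) • diracOp V X (a * b) + ((-(1 / 2) : ℂ) • diracOp V X a) * b
  rw [mul_smul_comm, smul_mul_assoc, ← smul_sub, ← smul_add, neg_smul, smul_neg]

end GroupAction

theorem FormalDeformation.infinitesimallyTrivial_of_coboundary {A : Type*} [Ring A] [Algebra ℂ A]
    (m : FormalDeformation A) (h : IsHochschildCoboundary (m.coeff 1)) :
    m.InfinitesimallyTrivial := by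
  obtain ⟨g, hg⟩ := h
  have h1 : ∀ a b, m.coeff 1 a b = a * g b - g (a * b) + g a * b := fun a b => by rw [hg]; rfl
  have h0 : ∀ a b, m.coeff 0 a b = a * b := fun a b => by rw [m.coeff_zero]; rfl
  -- The order-one condition reads `θ₁(a b) = θ₁(a) b + a θ₁(b) + m_1(a, b)`, that is `m_1 = -dθ₁`,
  -- which explains the sign.
  refine ⟨-g, fun a b n hn => ?_⟩
  interval_cases n
  · simp [extendedMul, h0]
  · simp [extendedMul, Finset.Nat.antidiagonal_succ, PowerSeries.coeff_succ_mul_X,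
      PowerSeries.coeff_C, h0, h1]
    abel

end
end FamilyAlgebra

open FamilyAlgebra in
theorem corollary5p6 {𝔤 : Type*} [LieRing 𝔤] [LieAlgebra ℂ 𝔤] [FiniteDimensional ℂ 𝔤]
    {V : Type*} [AddCommGroup V] [Module ℂ V] [FiniteDimensional ℂ V]
    [LieRingModule 𝔤 V] [LieModule ℂ 𝔤 V]
    {κ : Type*} [Fintype κ] (X : Module.Basis κ ℂ 𝔤) :
    -- the map along which the product is pulled back is bijective, also between the invariants
    (∀ t : ℂ, Function.Bijective (familyPBW 𝔤 V t)) ∧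
    (∀ t : ℂ, Set.BijOn (familyPBW 𝔤 V t)
      (classicalFamilyAlgebra 𝔤 V : Set (ClassicalMatrix 𝔤 V))
      (quantumFamilyAlgebra 𝔤 V t : Set (QuantumMatrix 𝔤 V t))) ∧
    -- the star-products form a unique formal deformation of the classical family algebra
    (∃! m : FormalDeformation (classicalFamilyAlgebra 𝔤 V), IsStarDeformation m) ∧
    -- its first-order term is half the Poisson bracket and a coboundary; it is inf. trivial
    ∀ m : FormalDeformation (classicalFamilyAlgebra 𝔤 V), IsStarDeformation m →
      (∀ a b : classicalFamilyAlgebra 𝔤 V, (m.coeff 1 a b : ClassicalMatrix 𝔤 V) =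
        (1 / 2 : ℂ) • familyPoisson V X (a : ClassicalMatrix 𝔤 V) (b : ClassicalMatrix 𝔤 V)) ∧
      IsHochschildCoboundary (m.coeff 1) ∧
      m.InfinitesimallyTrivial := by
  refine ⟨familyPBW_bijective, familyPBW_bijOn, ⟨starDeformation V X,
    isStarDeformation_starDeformation X, fun m hm => hm.eq_starDeformation X⟩, fun m hm => ?_⟩
  obtain rfl := hm.eq_starDeformation X
  have h : IsHochschildCoboundary ((starDeformation V X).coeff 1) :=
    ⟨familyCochain V X, familyCoeff_one X⟩
  refine ⟨fun a b => ?_, h, FormalDeformation.infinitesimallyTrivial_of_coboundary _ h⟩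
  exact congrArg (fun f => f (a : ClassicalMatrix 𝔤 V) (b : ClassicalMatrix 𝔤 V)) (starCoeff_one X)
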